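/- **Setting.** Let $A\in\mathbb R^{\widetilde m\times m}$, $B\in\mathbb R^{n\times\widetilde n}$, $S\in\mathbb R^{\widetilde m\times\widetilde n}$, $C\in\mathbb R^{m\times n}$, $\alpha\in\mathbb R^m$, $\beta\in\mathbb R^n$, let $\lambda_1,\lambda_2\ge 0$, let $\mathcal G$ be a partition of $\{1,\dots,m\}\times\{1,\dots,n\}$ into nonempty groups with weights $\omega_G\ge 0$, and let $\mathcal K_r\in\{\{0\}^m,\mathbb R^m_+\}$, $\mathcal K_c\in\{\{0\}^n,\mathbb R^n_+\}$. For $X\in\mathbb R^{m\times n}$ let $x_G$ be the vector of the entries of $X$ indexed by $G$. Norms are Euclidean (Frobenius for matrices), $\delta_K$ is the indicator function of $K$ (zero on $K$, $+\infty$ elsewhere), and $\Pi_K$ is the projection onto $K$. Put $$p(X)=\lambda_1\sum_{G\in\mathcal G}\omega_G\|x_G\|+\tfrac{\lambda_2}{2}\|X\|_F^2+\delta_{\mathbb R_+^{m\times n}}(X),\qquad p_r=\delta_{\mathcal K_r},\qquad p_c=\delta_{\mathcal K_c}.$$ For a function $f$ and $\nu>0$ let $\mathtt M_{\nu f}(x)=\min_y\{f(y)+\frac1{2\nu}\|y-x\|^2\}$,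 and let $\mathtt{prox}_{\nu f}(x)$ be the minimizer; for $\zeta=0$ put $\mathtt{prox}_{\zeta\|\cdot\|}=\mathrm{id}$. Let $\partial F(x)$ denote the Clarke generalized Jacobian of $F$ at $x$, i.e. the convex hull of all limits of Jacobians of $F$ at points of differentiability tending to $x$. Let $\sigma,\tau>0$, let $(\widehat W,\widehat u,\widehat v)\in\mathbb R^{\widetilde m\times\widetilde n}\times\mathbb R^m\times\mathbb R^n$ and $(\widehat X,\widehat y,\widehat z)\in\mathbb R^{m\times n}\times\mathbb R^m\times\mathbb R^n$ be given, put $T(W,u,v)=u\mathbf 1_n^\top+\mathbf 1_mv^\top+A^\top WB^\top$ and $V=\widehat X+\sigma(T(W,u,v)-C)$, and let $$\begin{aligned}\Psi(W,u,v)=&-\langle S,W\rangle-\langle\alpha,u\rangle-\langle\beta,v\rangle-\tfrac1{2\sigma}\big(\|\widehat X\|_F^2+\|\widehat y\|^2+\|\widehat z\|^2\big)-\mathtt M_{\sigma p}(V)+\tfrac1{2\sigma}\|V\|_F^2\\&-\mathtt M_{\sigma p_r}(\widehat y+\sigma u)+\tfrac1{2\sigma}\|\widehat y+\sigma u\|^2-\mathtt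 M_{\sigma p_c}(\widehat z+\sigma v)+\tfrac1{2\sigma}\|\widehat z+\sigma v\|^2\\&+\tfrac{\tau}{2\sigma}\big(\|W-\widehat W\|_F^2+\|u-\widehat u\|^2+\|v-\widehat v\|^2\big).\end{aligned}$$ **Surrogate Jacobians.** For $G\in\mathcal G$ let $\mathcal X_G(x_G)$ be the set of all $\frac1{\sigma\lambda_2+1}\mathcal J_1\mathcal J_2$ with $\mathcal J_1\in\partial\mathtt{prox}_{\zeta_G\|\cdot\|}\big(\frac1{\sigma\lambda_2+1}\Pi_{\mathbb R_+^{|G|}}(x_G)\big)$, $\zeta_G=\frac{\sigma\lambda_1\omega_G}{\sigma\lambda_2+1}$, and $\mathcal J_2\in\partial\Pi_{\mathbb R_+^{|G|}}(x_G)$. Let $\mathcal X(X)$ be the set of the linear operators $\mathcal J$ on $\mathbb R^{m\times n}$ for which there are $\mathcal J_G\in\mathcal X_G(x_G)$, $G\in\mathcal G$, with $[\mathcal J(Z)]_G=\mathcal J_G z_G$ for all $Z$ and $G$. Let $\mathcal Y=\partial\mathtt{prox}_{\sigma p_r}$ and $\mathcal Z=\partial\mathtt{prox}_{\sigma p_c}$.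 Let $\widehat\partial(\nabla\Psi)(W,u,v)$ be the set of all linear operators $$H\begin{pmatrix}\Delta W\\\Delta u\\\Delta v\end{pmatrix}=\begin{pmatrix}\sigma A\,\mathcal J_{\mathcal X}(T\Delta)\,B+\frac\tau\sigma\Delta W\\ \sigma\,\mathcal J_{\mathcal X}(T\Delta)\mathbf 1_n+\sigma\mathcal J_{\mathcal Y}\Delta u+\frac\tau\sigma\Delta u\\ \sigma\,\mathcal J_{\mathcal X}(T\Delta)^\top\mathbf 1_m+\sigma\mathcal J_{\mathcal Z}\Delta v+\frac\tau\sigma\Delta v\end{pmatrix},\qquad T\Delta=T(\Delta W,\Delta u,\Delta v),$$ with $\mathcal J_{\mathcal X}\in\mathcal X(V)$, $\mathcal J_{\mathcal Y}\in\mathcal Y(\widehat y+\sigma u)$, $\mathcal J_{\mathcal Z}\in\mathcal Z(\widehat z+\sigma v)$. **Algorithm (semismooth Newton method).** Let $\bar\eta\in(0,1)$, $\gamma\in(0,1]$, $\mu\in(0,1/2)$, $\delta\in(0,1)$, and let $x^0=(W^0,u^0,v^0)$ be any initial point. Given $x^j=(W^j,u^j,v^j)$: choose any $\mathcal H_j\in\widehat\partial(\nabla\Psi)(x^j)$.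 Let $d^j$ be either the exact solution of $\mathcal H_jd=-\nabla\Psi(x^j)$, or any iterate of the preconditioned conjugate gradient method for this system (in exact arithmetic, started from $0$, with any self-adjoint positive definite preconditioner) such that $$\|\mathcal H_jd^j+\nabla\Psi(x^j)\|\le\min\big(\bar\eta,\|\nabla\Psi(x^j)\|^{1+\gamma}\big).$$ Let $i_j$ be the smallest integer $i\ge 0$ with $\Psi(x^j+\delta^id^j)\le\Psi(x^j)+\mu\delta^i\langle\nabla\Psi(x^j),d^j\rangle$, and put $x^{j+1}=x^j+\delta^{i_j}d^j$. **Theorem 4.1.** The function $\Psi$ is differentiable and the equation $\nabla\Psi=0$ has a unique solution $x^*=(W^*,u^*,v^*)$. The algorithm is well defined: at every point $x$, the set $\widehat\partial(\nabla\Psi)(x)$ is nonempty; each of its elements $H$ is self-adjoint positive definite; the linear system $Hd=-\nabla\Psi(x)$ is solvable, and for every preconditioner some conjugate gradient iterate passes the stopping test; and for every admissible direction some $i\ge0$ passes the line search test. In particular, from every initial point the algorithm generates an infinite sequence. Every sequence $\{x^j\}$ generated by the algorithm converges to $x^*$, and there are a constant $c$ and an index $j_0$ such that for all $j\ge j_0$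 $$\|x^{j+1}-x^*\|\le c\,\|x^j-x^*\|^{1+\gamma}.$$ -/

import Mathlib

open Filter Topology

noncomputable section

namespace OT

/-! ### Convex analysis -/

section ConvexAnalysis

variable {E : Type*} [NormedAddCommGroup E] [InnerProductSpace ℝ E]

/-- The indicator function of a set in the sense of convex analysis: `0` on `K`, `+∞` off `K`. -/
def indicatorFn (K : Set E) (x : E) : EReal :=
  open Classical in if x ∈ K then 0 else ⊤

/-- The objective `y ↦ f y + ‖y - x‖² / (2ν)` whose minimum over `y` is the Moreau envelope
of `ν f` at `x`, and whose minimizer is the proximal point. -/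
def moreauObjective (ν : ℝ) (f : E → EReal) (x y : E) : EReal :=
  f y + ((1 / (2 * ν) * ‖y - x‖ ^ 2 : ℝ) : EReal)

/-- The Moreau envelope of `ν f` at `x`. -/
def moreauEnv (ν : ℝ) (f : E → EReal) (x : E) : ℝ :=
  (⨅ y, moreauObjective ν f x y).toReal

/-- The proximal mapping of `ν f`: the minimizer of the objective above. -/
def prox (ν : ℝ) (f : E → EReal) (x : E) : E :=
  Classical.epsilon fun y => ∀ z, moreauObjective ν f x y ≤ moreauObjective ν f x z

/-- The projection onto a (closed convex) set `K`: the point of `K` nearest to `x`. -/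
def proj (K : Set E) (x : E) : E :=
  Classical.epsilon fun y => y ∈ K ∧ ∀ z ∈ K, ‖y - x‖ ≤ ‖z - x‖

/-- Clarke's generalized Jacobian of `f` at `x`: the convex hull of all limits of the Jacobians
of `f` at points of differentiability tending to `x`. -/
def clarkeJacobian (f : E → E) (x : E) : Set (E →L[ℝ] E) :=
  convexHull ℝ {L | ∃ s : ℕ → E, Tendsto s atTop (𝓝 x) ∧ (∀ k, DifferentiableAt ℝ f (s k)) ∧
    Tendsto (fun k => fderiv ℝ f (s k)) atTop (𝓝 L)}

/-- Self-adjoint positive definite operators. -/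
def IsSPD (H : E →L[ℝ] E) : Prop :=
  (∀ a b, inner ℝ (H a) b = inner ℝ a (H b)) ∧ ∀ a, a ≠ 0 → 0 < inner ℝ a (H a)

/-- The state of the preconditioned conjugate gradient method for `H d = b`, started from `0`:
the current approximation `d`, its residual `r = b - H d`, and the search direction `q`. -/
structure PCGState (E : Type*) where
  d : E
  r : E
  q : E

/-- The preconditioned conjugate gradient method for `H d = b`, started from `0`; `P` is the
inverse of the preconditioner. Once the residual vanishes the method stays where it is
(every quotient below is then `0` by Lean's convention for division by `0`). -/
def pcg (H P : E →L[ℝ] E) (b : E) : ℕ → PCGState E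
  | 0 => ⟨0, b, P b⟩
  | k + 1 =>
    let s := pcg H P b k
    let a : ℝ := inner ℝ s.r (P s.r) / inner ℝ s.q (H s.q)
    let r' : E := s.r - a • H s.q
    let c : ℝ := inner ℝ r' (P r') / inner ℝ s.r (P s.r)
    ⟨s.d + a • s.q, r', P r' + c • s.q⟩

end ConvexAnalysis

/-- The nonnegative orthant. -/
def orthant (ι : Type*) : Set (EuclideanSpace ℝ ι) := {x | ∀ i, 0 ≤ x i}

/-! ### The problem data -/

/-- `m × n` matrices with the Frobenius norm and inner product. -/
abbrev Mat (m n : ℕ) := EuclideanSpace ℝ (Fin m × Fin n)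

/-- Triples `(W, u, v)` of an `m' × n'` matrix, an `m`-vector and an `n`-vector, with the Euclidean
(Frobenius) norm of the triple. -/
abbrev Vars (m n m' n' : ℕ) := EuclideanSpace ℝ ((Fin m' × Fin n') ⊕ (Fin m ⊕ Fin n))

/-- The two possible cones for the slack of a marginal constraint: zero (equality constraint) and
the nonnegative orthant (inequality constraint). -/
inductive ConeKind
  | zero
  | orthant

/-- The cone in `ℝ^ι` of the given kind. -/
def ConeKind.cone (ι : Type*) : ConeKind → Set (EuclideanSpace ℝ ι)
  | .zero => {0}
  | .orthant => OT.orthant ι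

/-- The data of the group-quadratic regularized optimal transport problem
`min ⟨C, X⟩ + λ₁ ∑_G ω_G ‖x_G‖ + (λ₂ / 2) ‖X‖²` subject to
`A X B = S`, `α - X 1 ∈ K_r`, `β - Xᵀ 1 ∈ K_c`, `X ≥ 0`. -/
structure Problem (m n m' n' : ℕ) where
  A : Matrix (Fin m') (Fin m) ℝ
  B : Matrix (Fin n) (Fin n') ℝ
  S : Matrix (Fin m') (Fin n') ℝ
  C : Matrix (Fin m) (Fin n) ℝ
  α : EuclideanSpace ℝ (Fin m)
  β : EuclideanSpace ℝ (Fin n)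
  /-- the partition of the index set into nonempty groups -/
  groups : Finpartition (Finset.univ : Finset (Fin m × Fin n))
  /-- the weights of the groups -/
  ω : Finset (Fin m × Fin n) → ℝ
  lam₁ : ℝ
  lam₂ : ℝ
  Kr : ConeKind
  Kc : ConeKind
  ω_nonneg : ∀ G ∈ groups.parts, 0 ≤ ω G
  lam₁_nonneg : 0 ≤ lam₁
  lam₂_nonneg : 0 ≤ lam₂

/-- The data of one augmented Lagrangian subproblem: the parameters `σ, τ > 0` and the current
point `(Ŵ, û, v̂, X̂, ŷ, ẑ)`, where `hat` is `(Ŵ, û, v̂)`. -/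
structure Subproblem (m n m' n' : ℕ) where
  σ : ℝ
  τ : ℝ
  hat : Vars m n m' n'
  X : Mat m n
  y : EuclideanSpace ℝ (Fin m)
  z : EuclideanSpace ℝ (Fin n)
  σ_pos : 0 < σ
  τ_pos : 0 < τ

/-- The parameters of the semismooth Newton method. -/
structure SSNParams where
  ηbar : ℝ
  γ : ℝ
  μ : ℝ
  δ : ℝ
  ηbar_mem : ηbar ∈ Set.Ioo (0 : ℝ) 1
  γ_mem : γ ∈ Set.Ioc (0 : ℝ) 1
  μ_mem : μ ∈ Set.Ioo (0 : ℝ) (1 / 2)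
  δ_mem : δ ∈ Set.Ioo (0 : ℝ) 1

section Blocks

variable {m n m' n' : ℕ}

/-- The matrix of an element of `Mat m n`. -/
def toMatrix (X : Mat m n) : Matrix (Fin m) (Fin n) ℝ := Matrix.of fun i j => X (i, j)

/-- The element of `Mat m n` with the given entries. -/
def ofMatrix (X : Matrix (Fin m) (Fin n) ℝ) : Mat m n := WithLp.toLp 2 fun ij => X ij.1 ij.2

/-- The vector `x_G` of the entries of `X` indexed by `G`. -/
def group (G : Finset (Fin m × Fin n)) (X : Mat m n) : EuclideanSpace ℝ G :=
  WithLp.toLp 2 fun ij => X ij.1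

/-- The block `W` of `(W, u, v)`. -/
def Wpart (x : Vars m n m' n') : Matrix (Fin m') (Fin n') ℝ :=
  Matrix.of fun i j => x (Sum.inl (i, j))

/-- The block `u` of `(W, u, v)`. -/
def upart (x : Vars m n m' n') : EuclideanSpace ℝ (Fin m) :=
  WithLp.toLp 2 fun i => x (Sum.inr (Sum.inl i))

/-- The block `v` of `(W, u, v)`. -/
def vpart (x : Vars m n m' n') : EuclideanSpace ℝ (Fin n) :=
  WithLp.toLp 2 fun j => x (Sum.inr (Sum.inr j))

/-- The triple `(W, u, v)`. -/
def mkVars (W : Matrix (Fin m') (Fin n') ℝ) (u : Fin m → ℝ) (v : Fin n → ℝ) : Vars m n m' n' :=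
  WithLp.toLp 2 (Sum.elim (fun ij => W ij.1 ij.2) (Sum.elim u v))

end Blocks

namespace Problem

variable {m n m' n' : ℕ} (D : Problem m n m' n') (Q : Subproblem m n m' n')

/-- `p(X) = λ₁ ∑_G ω_G ‖x_G‖ + (λ₂ / 2) ‖X‖² + δ_{X ≥ 0}(X)`. -/
def p (X : Mat m n) : EReal :=
  ((D.lam₁ * ∑ G ∈ D.groups.parts, D.ω G * ‖group G X‖ + D.lam₂ / 2 * ‖X‖ ^ 2 : ℝ) : EReal)
    + indicatorFn (orthant (Fin m × Fin n)) X

/-- `p_r`, the indicator function of `K_r`. -/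
def pr : EuclideanSpace ℝ (Fin m) → EReal := indicatorFn (D.Kr.cone (Fin m))

/-- `p_c`, the indicator function of `K_c`. -/
def pc : EuclideanSpace ℝ (Fin n) → EReal := indicatorFn (D.Kc.cone (Fin n))

/-- The linear map `(W, u, v) ↦ u 1ᵀ + 1 vᵀ + Aᵀ W Bᵀ`. -/
def lift (x : Vars m n m' n') : Mat m n :=
  ofMatrix (Matrix.of (fun i j => upart x i + vpart x j)
    + D.A.transpose * Wpart x * D.B.transpose)

/-- The argument `X̂ + σ (u 1ᵀ + 1 vᵀ + Aᵀ W Bᵀ - C)` of `prox_{σ p}`. -/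
def argX (x : Vars m n m' n') : Mat m n := Q.X + Q.σ • (D.lift x - ofMatrix D.C)

/-- The augmented Lagrangian `L_σ(W, u, v, X̂, ŷ, ẑ)` of the dual problem, in `x = (W, u, v)`. -/
def augLagrangian (x : Vars m n m' n') : ℝ :=
  - (∑ i, ∑ j, D.S i j * Wpart x i j) - inner ℝ D.α (upart x) - inner ℝ D.β (vpart x)
  - 1 / (2 * Q.σ) * ‖Q.X‖ ^ 2 - 1 / (2 * Q.σ) * ‖Q.y‖ ^ 2 - 1 / (2 * Q.σ) * ‖Q.z‖ ^ 2
  - moreauEnv Q.σ D.p (D.argX Q x) + 1 / (2 * Q.σ) * ‖D.argX Q x‖ ^ 2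
  - moreauEnv Q.σ D.pr (Q.y + Q.σ • upart x) + 1 / (2 * Q.σ) * ‖Q.y + Q.σ • upart x‖ ^ 2
  - moreauEnv Q.σ D.pc (Q.z + Q.σ • vpart x) + 1 / (2 * Q.σ) * ‖Q.z + Q.σ • vpart x‖ ^ 2

/-- The objective `Ψ` of the subproblem. -/
def Psi (x : Vars m n m' n') : ℝ :=
  D.augLagrangian Q x + Q.τ / (2 * Q.σ) * ‖x - Q.hat‖ ^ 2

/-! ### The surrogate generalized Jacobian -/

/-- `𝒳_G(x_G)`: the products `(σ λ₂ + 1)⁻¹ J₁ J₂`, where `J₁` is in the Clarke Jacobian of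
`prox_{ζ ‖·‖}`, `ζ = σ λ₁ ω_G / (σ λ₂ + 1)`, at `(σ λ₂ + 1)⁻¹ Π(x_G)`, and `J₂` is in the Clarke
Jacobian at `x_G` of the projection `Π` onto the nonnegative orthant. -/
def jacXGroup (G : Finset (Fin m × Fin n)) (x : EuclideanSpace ℝ G) :
    Set (EuclideanSpace ℝ G →L[ℝ] EuclideanSpace ℝ G) :=
  {J | ∃ J₁ ∈ clarkeJacobian
        (prox 1 fun z : EuclideanSpace ℝ G =>
          ((Q.σ * D.lam₁ * D.ω G / (Q.σ * D.lam₂ + 1) * ‖z‖ : ℝ) : EReal))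
        ((1 / (Q.σ * D.lam₂ + 1)) • proj (orthant G) x),
      ∃ J₂ ∈ clarkeJacobian (proj (orthant G)) x,
        J = (1 / (Q.σ * D.lam₂ + 1)) • J₁.comp J₂}

/-- `𝒳(X)`: the operators that act on each group `G` as an element of `𝒳_G(x_G)`. -/
def jacX (X : Mat m n) : Set (Mat m n →L[ℝ] Mat m n) :=
  {J | ∀ G ∈ D.groups.parts, ∃ JG ∈ D.jacXGroup Q G (group G X),
    ∀ Z, group G (J Z) = JG (group G Z)}

/-- `𝒴`, the Clarke Jacobian of `prox_{σ p_r}`. -/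
def jacY (y : EuclideanSpace ℝ (Fin m)) :
    Set (EuclideanSpace ℝ (Fin m) →L[ℝ] EuclideanSpace ℝ (Fin m)) :=
  clarkeJacobian (prox Q.σ D.pr) y

/-- `𝒵`, the Clarke Jacobian of `prox_{σ p_c}`. -/
def jacZ (z : EuclideanSpace ℝ (Fin n)) :
    Set (EuclideanSpace ℝ (Fin n) →L[ℝ] EuclideanSpace ℝ (Fin n)) :=
  clarkeJacobian (prox Q.σ D.pc) z

/-- The surrogate generalized Jacobian of `∇Ψ` at `x = (W, u, v)`. -/
def jacGradPsi (x : Vars m n m' n') : Set (Vars m n m' n' →L[ℝ] Vars m n m' n') :=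
  {H | ∃ JX ∈ D.jacX Q (D.argX Q x), ∃ JY ∈ D.jacY Q (Q.y + Q.σ • upart x),
      ∃ JZ ∈ D.jacZ Q (Q.z + Q.σ • vpart x),
    ∀ h, H h = mkVars
      (Q.σ • (D.A * toMatrix (JX (D.lift h)) * D.B) + (Q.τ / Q.σ) • Wpart h)
      (fun i => Q.σ * (∑ j, toMatrix (JX (D.lift h)) i j) + Q.σ * JY (upart h) i
        + Q.τ / Q.σ * upart h i)
      (fun j => Q.σ * (∑ i, toMatrix (JX (D.lift h)) i j) + Q.σ * JZ (vpart h) j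
        + Q.τ / Q.σ * vpart h j)}

/-! ### The semismooth Newton method -/

variable (R : SSNParams)

/-- The stopping test for the linear system `H d = -∇Ψ(x)`. -/
def ResidualTest (H : Vars m n m' n' →L[ℝ] Vars m n m' n') (x d : Vars m n m' n') : Prop :=
  ‖H d + gradient (D.Psi Q) x‖ ≤ min R.ηbar (‖gradient (D.Psi Q) x‖ ^ (1 + R.γ))

/-- `d` is an admissible direction at `x` for `H`: the exact solution of `H d = -∇Ψ(x)` (direct
solver), or an iterate of the preconditioned conjugate gradient method for this system, with some
preconditioner, which passes the stopping test. -/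
def IsDirection (H : Vars m n m' n' →L[ℝ] Vars m n m' n') (x d : Vars m n m' n') : Prop :=
  H d = - gradient (D.Psi Q) x ∨
  ((∃ P : Vars m n m' n' →L[ℝ] Vars m n m' n', IsSPD P ∧
      ∃ k, d = (pcg H P (- gradient (D.Psi Q) x) k).d) ∧ D.ResidualTest Q R H x d)

/-- The Armijo test at `x` with direction `d` and step size `δ ^ i`. -/
def Armijo (x d : Vars m n m' n') (i : ℕ) : Prop :=
  D.Psi Q (x + R.δ ^ i • d) ≤ D.Psi Q x + R.μ * R.δ ^ i * inner ℝ (gradient (D.Psi Q) x) d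

/-- One iteration of the method leads from `x` to `x'`. -/
def SSNStep (x x' : Vars m n m' n') : Prop :=
  ∃ H ∈ D.jacGradPsi Q x, ∃ d, D.IsDirection Q R H x d ∧
    ∃ i, IsLeast {i | D.Armijo Q R x d i} i ∧ x' = x + R.δ ^ i • d

/-- `x` is a sequence generated by the method (from its starting point `x 0`). -/
def IsSSNSequence (x : ℕ → Vars m n m' n') : Prop :=
  ∀ j, D.SSNStep Q R (x j) (x (j + 1))

end Problem

end OT

end

/-! Write M for the Moreau envelope with parameter σ of a convex function. Then φ = ½‖·‖² - σM is
convex and its gradient is the proximal mapping (`proxPotential`, `IsProx.potential_lower`). Up to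
an affine term, `Psi` is the sum of three functions (1/σ) φ(σ T x + c) with T linear and of the
proximal term (τ/2σ)‖x - hat‖². Hence it is strongly convex with modulus τ/σ and has a Lipschitz
gradient F, which gives the unique zero.

`IsSC1` collects what the Newton method needs of a function, its gradient and a set of generalized
derivatives. It is stable under sums and affine substitution, which reduces the problem to one group
and to the two cones. On a group the proximal mapping is soft thresholding after a scaled projection
Π onto the orthant. The surrogate operators κ J₁ J₂ are used without any claim that they belong to a
Clarke Jacobian. They are self-adjoint and positive semidefinite because J₂ fixes Π x
(`posJac_posVec`). They approximate the mapping to second order because J₂ (x - x₀) = Π x - Π x₀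
exactly for x near x₀ (`eventually_posJac_sub`) and because soft thresholding has bounded curvature
off its dead zone (`norm_shrink_newton_le`).

Every admissible direction has slope ⟨F x, d⟩ = -⟨d, H d⟩; for a conjugate gradient iterate this is
the orthogonality of residual and iterate (`inner_pcg_d`). So the Armijo steps are bounded below and
each step decreases `Psi` by a multiple of the squared error (`exists_decrease`), which gives global
convergence. Near the solution xs, with e = ‖x - xs‖, the full step has error O(e^(1+γ))
(`exists_newton_error`). It is accepted (`eventually_unit_step`) because Ψ(x) - Ψ(xs) = ½⟨F x, x -
xs⟩ + O(e³) while Ψ(x + d) - Ψ(xs) = o(e²): it gains about half the predicted slope, and μ < 1/2. -/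

noncomputable section

namespace OT

/-! ### Inexact Newton methods with line search for strongly convex functions with semismooth
gradient. -/

section Newton

variable {E : Type*} [NormedAddCommGroup E] [InnerProductSpace ℝ E]

/-- `f` is a strongly convex function (with modulus `κ`, which may be `0`) with Lipschitz gradient
`F`, and `J` is a generalized derivative of `F`, for which `F` is strongly semismooth; the
last condition says that the trapezoidal rule for `f` is exact up to third order. -/
structure IsSC1 (κ : ℝ) (f : E → ℝ) (F : E → E) (J : E → Set (E →L[ℝ] E)) : Prop where
  lower : ∀ x y, f x + inner ℝ (F x) (y - x) + κ / 2 * ‖y - x‖ ^ 2 ≤ f y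
  lip : ∃ L, ∀ x y, ‖F x - F y‖ ≤ L * ‖x - y‖
  symm : ∀ x, ∀ H ∈ J x, ∀ a b, inner ℝ (H a) b = inner ℝ a (H b)
  coercive : ∀ x, ∀ H ∈ J x, ∀ a, κ * ‖a‖ ^ 2 ≤ inner ℝ a (H a)
  bound : ∃ L, ∀ x, ∀ H ∈ J x, ∀ a, ‖H a‖ ≤ L * ‖a‖
  newton : ∀ x₀, ∃ C, ∀ᶠ x in 𝓝 x₀, ∀ H ∈ J x, ‖F x - F x₀ - H (x - x₀)‖ ≤ C * ‖x - x₀‖ ^ 2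
  trapezoid : ∀ x₀, ∃ C, ∀ᶠ x in 𝓝 x₀,
    |f x - f x₀ - 1 / 2 * inner ℝ (F x + F x₀) (x - x₀)| ≤ C * ‖x - x₀‖ ^ 3

/-- The properties of an (inexact) Newton direction `d` for the system `H d = -g` which the
convergence analysis uses. -/
def IsInexactDirection (η γ : ℝ) (H : E →L[ℝ] E) (g d : E) : Prop :=
  inner ℝ g d = - inner ℝ d (H d) ∧ ‖H d + g‖ ≤ min η (‖g‖ ^ (1 + γ))

/-- One step of a Newton method with Armijo line search for the minimization of `f`. -/
def NewtonStep (R : SSNParams) (f : E → ℝ) (F : E → E) (J : E → Set (E →L[ℝ] E)) (x x' : E) :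
    Prop :=
  ∃ H ∈ J x, ∃ d, IsInexactDirection R.ηbar R.γ H (F x) d ∧
    ∃ i, IsLeast {i : ℕ | f (x + R.δ ^ i • d) ≤ f x + R.μ * R.δ ^ i * inner ℝ (F x) d} i ∧
      x' = x + R.δ ^ i • d

theorem hasFDerivAt_of_quadratic_bound {E F : Type*} [NormedAddCommGroup E] [NormedSpace ℝ E]
    [NormedAddCommGroup F] [NormedSpace ℝ F] {f : E → F} {L : E →L[ℝ] F} {x : E} {C : ℝ}
    (h : ∀ᶠ y in 𝓝 x, ‖f y - f x - L (y - x)‖ ≤ C * ‖y - x‖ ^ 2) : HasFDerivAt f L x := by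
  have key : HasFDerivAt (fun y => f y - f x - L (y - x)) (0 : E →L[ℝ] F) x := by
    refine Asymptotics.IsBigO.hasFDerivAt (n := 2) ?_ (by norm_num)
    refine Asymptotics.IsBigO.of_bound C (h.mono fun y hy => ?_)
    rwa [Real.norm_eq_abs, abs_of_nonneg (by positivity : 0 ≤ ‖y - x‖ ^ 2)]
  have h2 : HasFDerivAt (fun y => L (y - x)) L x := by
    simpa using (L.hasFDerivAt (x := x)).sub_const (L x)
  have h3 := (key.add h2).add_const (f x)
  simpa [Pi.add_def] using h3

/-- A minimum is at most any weighted geometric mean of its arguments; the weights γ/(1+γ) and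
1/(1+γ) make the bound linear in g. For η < 1 the stopping test thus bounds the relative residual by
a factor below one, also far from the solution. -/
theorem min_rpow_le {η γ g : ℝ} (hη : 0 < η) (hγ : 0 < γ) (hg : 0 ≤ g) :
    min η (g ^ (1 + γ)) ≤ η ^ (γ / (1 + γ)) * g := by
  have h1 : 0 < 1 + γ := by linarith
  set a := min η (g ^ (1 + γ)) with ha
  have ha0 : 0 ≤ a := le_min hη.le (Real.rpow_nonneg hg _)
  have e : a = a ^ (γ / (1 + γ)) * a ^ (1 / (1 + γ)) := by
    rw [← Real.rpow_add_of_nonneg ha0 (by positivity) (by positivity), ← add_div,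
      add_comm γ 1, div_self h1.ne', Real.rpow_one]
  rw [e]
  have h2 : a ^ (γ / (1 + γ)) ≤ η ^ (γ / (1 + γ)) :=
    Real.rpow_le_rpow ha0 (min_le_left _ _) (by positivity)
  have h3 : a ^ (1 / (1 + γ)) ≤ g := by
    calc a ^ (1 / (1 + γ)) ≤ (g ^ (1 + γ)) ^ (1 / (1 + γ)) :=
          Real.rpow_le_rpow ha0 (min_le_right _ _) (by positivity)
      _ = g := by rw [← Real.rpow_mul hg, mul_one_div_cancel h1.ne', Real.rpow_one]
  exact mul_le_mul h2 h3 (Real.rpow_nonneg ha0 _) (Real.rpow_nonneg hη.le _)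

namespace IsSC1

variable {κ : ℝ} {f : E → ℝ} {F : E → E} {J : E → Set (E →L[ℝ] E)}

theorem mono (h : IsSC1 κ f F J) {J' : E → Set (E →L[ℝ] E)} (hJ : ∀ x, J' x ⊆ J x) :
    IsSC1 κ f F J' where
  lower := h.lower
  lip := h.lip
  symm x H hH := h.symm x H (hJ x hH)
  coercive x H hH := h.coercive x H (hJ x hH)
  bound := h.bound.imp fun _ hL x H hH => hL x H (hJ x hH)
  newton x₀ := (h.newton x₀).imp fun _ hC => hC.mono fun x hx H hH => hx H (hJ x hH)
  trapezoid := h.trapezoid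

theorem exists_lip (h : IsSC1 κ f F J) : ∃ L, 0 < L ∧ (∀ x y, ‖F x - F y‖ ≤ L * ‖x - y‖) ∧
    (∀ x, ∀ H ∈ J x, ∀ a, ‖H a‖ ≤ L * ‖a‖) := by
  obtain ⟨L, hL⟩ := h.lip
  obtain ⟨K, hK⟩ := h.bound
  refine ⟨max (max L K) 1, lt_max_of_lt_right one_pos, fun x y => (hL x y).trans ?_,
    fun x H hH a => (hK x H hH a).trans ?_⟩
  · gcongr; exact (le_max_left _ _).trans (le_max_left _ _)
  · gcongr; exact (le_max_right _ _).trans (le_max_left _ _)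

theorem monotone (h : IsSC1 κ f F J) (x y : E) :
    κ * ‖x - y‖ ^ 2 ≤ inner ℝ (F x - F y) (x - y) := by
  have h1 := h.lower x y
  have h2 := h.lower y x
  have e : inner ℝ (F x) (y - x) = - inner ℝ (F x) (x - y) := by
    rw [← inner_neg_right, neg_sub]
  rw [norm_sub_rev y x, e] at h1
  rw [inner_sub_left]
  linarith

/-- Descent lemma. The gradient inequality at `y` replaces integration along the segment, at the
price of `L` instead of `L / 2`. -/
theorem upper (hκ : 0 ≤ κ) (h : IsSC1 κ f F J) {L : ℝ} (hL : ∀ x y, ‖F x - F y‖ ≤ L * ‖x - y‖)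
    (x y : E) : f y ≤ f x + inner ℝ (F x) (y - x) + L * ‖y - x‖ ^ 2 := by
  have h1 := h.lower y x
  have e : inner ℝ (F y) (x - y) = - inner ℝ (F y) (y - x) := by
    rw [← inner_neg_right, neg_sub]
  have h2 : inner ℝ (F y - F x) (y - x) ≤ L * ‖y - x‖ * ‖y - x‖ :=
    (real_inner_le_norm _ _).trans (by gcongr; exact hL y x)
  rw [inner_sub_left] at h2
  have : 0 ≤ κ / 2 * ‖x - y‖ ^ 2 := by positivity
  nlinarith

/-- Differentiability need not be part of `IsSC1`: `lower` and `upper` squeeze the remainder to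
second order. -/
theorem hasGradientAt [CompleteSpace E] (hκ : 0 ≤ κ) (h : IsSC1 κ f F J) (x : E) :
    HasGradientAt f (F x) x := by
  obtain ⟨L, hL0, hL, -⟩ := h.exists_lip
  rw [hasGradientAt_iff_hasFDerivAt]
  refine hasFDerivAt_of_quadratic_bound (C := L) (Eventually.of_forall fun y => ?_)
  have h1 := h.lower x y
  have h2 := h.upper hκ hL x y
  have h3 : 0 ≤ κ / 2 * ‖y - x‖ ^ 2 := by positivity
  have h4 : 0 ≤ L * ‖y - x‖ ^ 2 := by positivity
  rw [InnerProductSpace.toDual_apply_apply, Real.norm_eq_abs, abs_le]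
  constructor <;> linarith

theorem exists_zero [CompleteSpace E] (hκ : 0 < κ) (h : IsSC1 κ f F J) :
    ∃ xs, ∀ x, F x = 0 ↔ x = xs := by
  obtain ⟨L, hL0, hL, -⟩ := h.exists_lip
  -- On the trivial space `L` may be smaller than `κ`; the maximum ensures 0 ≤ q.
  set K := max L κ with hK
  have hK0 : 0 < K := lt_max_of_lt_left hL0
  have hLK : ∀ x y, ‖F x - F y‖ ≤ K * ‖x - y‖ := fun x y =>
    (hL x y).trans (by gcongr; exact le_max_left _ _)
  have hκK : κ ≤ K := le_max_right _ _
  -- This `t` minimizes 1 - 2tκ + t²K², a bound for the squared Lipschitz constant of x ↦ x - t F x;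
  -- the minimum is `q`.
  set t := κ / K ^ 2 with ht
  have ht0 : 0 < t := by positivity
  set q := 1 - κ ^ 2 / K ^ 2 with hq
  have hq0 : 0 ≤ q := by
    rw [hq, sub_nonneg, div_le_one (by positivity)]; gcongr
  have hq1 : q < 1 := by
    have : 0 < κ ^ 2 / K ^ 2 := by positivity
    linarith
  have hcon : ContractingWith (Real.toNNReal (Real.sqrt q)) fun x => x - t • F x := by
    constructor
    · rw [← NNReal.coe_lt_coe, Real.coe_toNNReal _ (Real.sqrt_nonneg _), NNReal.coe_one,
        Real.sqrt_lt' one_pos]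
      simpa using hq1
    · refine LipschitzWith.of_dist_le_mul fun x y => ?_
      rw [Real.coe_toNNReal _ (Real.sqrt_nonneg _), dist_eq_norm, dist_eq_norm]
      refine abs_le_of_sq_le_sq' ?_ (by positivity) |>.2
      rw [mul_pow, Real.sq_sqrt hq0]
      have e : x - t • F x - (y - t • F y) = (x - y) - t • (F x - F y) := by
        rw [smul_sub]; abel
      rw [e, norm_sub_sq_real, norm_smul, inner_smul_right, real_inner_comm, Real.norm_eq_abs,
        abs_of_pos ht0]
      have h1 := h.monotone x y
      have h2 : (t * ‖F x - F y‖) ^ 2 ≤ (t * (K * ‖x - y‖)) ^ 2 := by gcongr; exact hLK x y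
      have h3 : t * (κ * ‖x - y‖ ^ 2) ≤ t * inner ℝ (F x - F y) (x - y) := by gcongr
      have e2 : (t * (K * ‖x - y‖)) ^ 2 = κ ^ 2 / K ^ 2 * ‖x - y‖ ^ 2 := by
        rw [ht]; field_simp
      have e3 : t * (κ * ‖x - y‖ ^ 2) = κ ^ 2 / K ^ 2 * ‖x - y‖ ^ 2 := by
        rw [ht]; field_simp
      rw [hq]
      nlinarith
  have hfix := hcon.fixedPoint_isFixedPt
  set xs := hcon.fixedPoint
  have hxs : F xs = 0 := by
    have : xs - t • F xs = xs := hfix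
    rw [sub_eq_self] at this
    exact (smul_eq_zero.1 this).resolve_left ht0.ne'
  refine ⟨xs, fun x => ⟨fun hx => ?_, fun hx => hx ▸ hxs⟩⟩
  have := h.monotone x xs
  rw [hx, hxs, sub_zero, inner_zero_left] at this
  have h0 : ‖x - xs‖ ^ 2 ≤ 0 := by
    by_contra hc
    push Not at hc
    nlinarith
  exact sub_eq_zero.1 (norm_eq_zero.1 (pow_eq_zero_iff two_ne_zero |>.1
    (le_antisymm h0 (sq_nonneg _))))

theorem isSPD (hκ : 0 < κ) (h : IsSC1 κ f F J) {x : E} {H : E →L[ℝ] E} (hH : H ∈ J x) :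
    IsSPD H := by
  refine ⟨h.symm x H hH, fun a ha => lt_of_lt_of_le ?_ (h.coercive x H hH a)⟩
  have := norm_pos_iff.2 ha
  positivity

theorem inner_direction_le (h : IsSC1 κ f F J) {η γ : ℝ} {x d : E} {H : E →L[ℝ] E} (hH : H ∈ J x)
    (hd : IsInexactDirection η γ H (F x) d) : inner ℝ (F x) d ≤ - (κ * ‖d‖ ^ 2) := by
  rw [hd.1]; exact neg_le_neg (h.coercive x H hH d)

/-- Every sufficiently small step passes the Armijo test. -/
theorem armijo_of_small (hκ : 0 < κ) (h : IsSC1 κ f F J) {L : ℝ} (hL0 : 0 < L)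
    (hL : ∀ x y, ‖F x - F y‖ ≤ L * ‖x - y‖) {x d : E} {μ s : ℝ}
    (hd : inner ℝ (F x) d ≤ - (κ * ‖d‖ ^ 2)) (hs : 0 ≤ s) (hsL : s ≤ (1 - μ) * κ / L) :
    f (x + s • d) ≤ f x + μ * s * inner ℝ (F x) d := by
  have h1 := h.upper hκ.le hL x (x + s • d)
  rw [add_sub_cancel_left, inner_smul_right, norm_smul, Real.norm_eq_abs, abs_of_nonneg hs] at h1
  rw [le_div_iff₀ hL0] at hsL
  have h2 : s * (s * L * ‖d‖ ^ 2) ≤ s * ((1 - μ) * (κ * ‖d‖ ^ 2)) := by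
    refine mul_le_mul_of_nonneg_left ?_ hs
    rw [← mul_assoc]
    gcongr
  have hd0 : 0 ≤ κ * ‖d‖ ^ 2 := by positivity
  by_cases hμ : μ ≤ 1
  · have h3 : s * ((1 - μ) * (κ * ‖d‖ ^ 2)) ≤ s * ((1 - μ) * (- inner ℝ (F x) d)) := by
      have : 0 ≤ 1 - μ := by linarith
      gcongr; linarith
    nlinarith
  · push Not at hμ
    have hs0 : s = 0 := by
      have : (1 - μ) * κ ≤ 0 := by nlinarith
      nlinarith
    simp [hs0]

theorem exists_armijo (hκ : 0 < κ) (h : IsSC1 κ f F J) (R : SSNParams) {x d : E}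
    (hd : inner ℝ (F x) d ≤ - (κ * ‖d‖ ^ 2)) :
    ∃ i : ℕ, f (x + R.δ ^ i • d) ≤ f x + R.μ * R.δ ^ i * inner ℝ (F x) d := by
  obtain ⟨L, hL0, hL, -⟩ := h.exists_lip
  have hpos : 0 < (1 - R.μ) * κ / L := by
    have : 0 < 1 - R.μ := by linarith [R.μ_mem.2]
    positivity
  obtain ⟨i, hi⟩ := exists_pow_lt_of_lt_one hpos R.δ_mem.2
  exact ⟨i, h.armijo_of_small hκ hL0 hL hd (pow_nonneg R.δ_mem.1.le _) hi.le⟩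

/-- Each step decreases the objective by a multiple of the squared error. -/
theorem exists_decrease (hκ : 0 < κ) (h : IsSC1 κ f F J) (R : SSNParams) {xs : E}
    (hxs : F xs = 0) : ∃ c > 0, ∀ x x', NewtonStep R f F J x x' →
      f x' ≤ f x - c * ‖x - xs‖ ^ 2 := by
  obtain ⟨L, hL0, hL, hHL⟩ := h.exists_lip
  set s₀ := (1 - R.μ) * κ / L with hs₀
  have hs₀0 : 0 < s₀ := by
    have : 0 < 1 - R.μ := by linarith [R.μ_mem.2]
    positivity
  have hδ := R.δ_mem.1
  have hμ := R.μ_mem.1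
  set s := min 1 (R.δ * s₀)
  have hs : 0 < s := lt_min one_pos (by positivity)
  set θ := R.ηbar ^ (R.γ / (1 + R.γ))
  have hγ := R.γ_mem.1
  have hθ : θ < 1 := Real.rpow_lt_one R.ηbar_mem.1.le R.ηbar_mem.2 (by positivity)
  have hθ' : 0 < 1 - θ := by linarith
  -- `s` bounds the step size below, κ‖d‖² bounds the negative slope below, and ‖d‖ is at least (1 -
  -- θ) κ / L times the error.
  refine ⟨R.μ * s * κ * ((1 - θ) / L * κ) ^ 2, by positivity, ?_⟩
  rintro x x' ⟨H, hH, d, hd, i, hi, rfl⟩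
  have hdec := h.inner_direction_le hH hd
  -- Either the unit step is accepted, or the last rejected step exceeds `s₀`, below which every
  -- step is accepted.
  have hstep : s ≤ R.δ ^ i := by
    rcases i with _ | i
    · simp [s]
    · have hn : ¬ (R.δ ^ i ≤ s₀) := fun hc =>
        absurd (hi.2 (h.armijo_of_small hκ hL0 hL hdec (pow_nonneg hδ.le i) hc)) (by simp)
      push Not at hn
      refine (min_le_right _ _).trans ?_
      rw [pow_succ, mul_comm]
      gcongr
  have hg : κ * ‖x - xs‖ ≤ ‖F x‖ := by
    have h1 := h.monotone x xs
    rw [hxs, sub_zero] at h1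
    have h2 := h1.trans (real_inner_le_norm _ _)
    rcases (norm_nonneg (x - xs)).eq_or_lt with h0 | h0
    · rw [← h0]; simp
    · exact le_of_mul_le_mul_right (by linarith [h2, sq ‖x - xs‖]) h0
  have hdn : (1 - θ) / L * κ * ‖x - xs‖ ≤ ‖d‖ := by
    have h1 := hd.2.trans (min_rpow_le R.ηbar_mem.1 hγ (norm_nonneg (F x)))
    have h2 : ‖F x‖ ≤ ‖H d + F x‖ + ‖H d‖ := by
      have := norm_sub_le (H d + F x) (H d)
      rwa [add_sub_cancel_left] at this
    have h3 := hHL x H hH d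
    have h4 : (1 - θ) * (κ * ‖x - xs‖) ≤ L * ‖d‖ :=
      (mul_le_mul_of_nonneg_left hg hθ'.le).trans (by nlinarith)
    rw [div_mul_eq_mul_div, div_mul_eq_mul_div, div_le_iff₀ hL0]
    linarith
  have hA : f (x + R.δ ^ i • d) ≤ f x + R.μ * R.δ ^ i * inner ℝ (F x) d := hi.1
  have h5 : R.μ * s * (κ * ((1 - θ) / L * κ * ‖x - xs‖) ^ 2) ≤
      R.μ * R.δ ^ i * (κ * ‖d‖ ^ 2) := by
    gcongr
  have h6 : R.μ * R.δ ^ i * (κ * ‖d‖ ^ 2) ≤ R.μ * R.δ ^ i * (- inner ℝ (F x) d) := by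
    gcongr; linarith
  rw [mul_pow] at h5
  linarith

/-- The values decrease and are bounded below, so their decrements tend to zero, and the decrements
dominate the squared errors. -/
theorem tendsto_of_newtonStep (hκ : 0 < κ) (h : IsSC1 κ f F J) (R : SSNParams) {xs : E}
    (hxs : F xs = 0) {x : ℕ → E} (hx : ∀ j, NewtonStep R f F J (x j) (x (j + 1))) :
    Tendsto x atTop (𝓝 xs) := by
  obtain ⟨c, hc, hdec⟩ := h.exists_decrease hκ R hxs
  have hdec' := fun j => hdec _ _ (hx j)
  have hanti : Antitone fun j => f (x j) := antitone_nat_of_succ_le fun j =>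
    (hdec' j).trans (sub_le_self _ (by positivity))
  have hbdd : BddBelow (Set.range fun j => f (x j)) := by
    refine ⟨f xs, ?_⟩
    rintro _ ⟨j, rfl⟩
    have := h.lower xs (x j)
    rw [hxs, inner_zero_left] at this
    have h0 : 0 ≤ κ / 2 * ‖x j - xs‖ ^ 2 := by positivity
    dsimp only
    linarith
  have hlim := tendsto_atTop_ciInf hanti hbdd
  have hdiff : Tendsto (fun j => (f (x j) - f (x (j + 1))) / c) atTop (𝓝 0) := by
    have := (hlim.sub (hlim.comp (tendsto_add_atTop_nat 1))).div_const c
    simpa using this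
  have hsq : Tendsto (fun j => ‖x j - xs‖ ^ 2) atTop (𝓝 0) := by
    refine squeeze_zero (fun j => by positivity) (fun j => ?_) hdiff
    rw [le_div_iff₀ hc]
    linarith [hdec' j]
  rw [tendsto_iff_norm_sub_tendsto_zero]
  have := (Real.continuous_sqrt.tendsto 0).comp hsq
  simpa [Function.comp_def, Real.sqrt_sq (norm_nonneg _)] using this

/-- A full Newton step reduces the error superlinearly. -/
theorem exists_newton_error (hκ : 0 < κ) (h : IsSC1 κ f F J) (R : SSNParams) {xs : E}
    (hxs : F xs = 0) : ∃ c > 0, ∀ᶠ x in 𝓝 xs, ∀ H ∈ J x, ∀ d,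
      IsInexactDirection R.ηbar R.γ H (F x) d → ‖x + d - xs‖ ≤ c * ‖x - xs‖ ^ (1 + R.γ) := by
  obtain ⟨L, hL0, hL, -⟩ := h.exists_lip
  obtain ⟨C, hC⟩ := h.newton xs
  have hγ := R.γ_mem.1
  have hγ1 := R.γ_mem.2
  refine ⟨(max C 0 + L ^ (1 + R.γ)) / κ, by positivity, ?_⟩
  filter_upwards [hC, Metric.ball_mem_nhds xs one_pos] with x hx hx1 H hH d hd
  rw [Metric.mem_ball, dist_eq_norm] at hx1
  set e := ‖x - xs‖
  have he0 : 0 ≤ e := norm_nonneg _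
  have h1 : ‖F x - H (x - xs)‖ ≤ max C 0 * e ^ (1 + R.γ) := by
    have := hx H hH
    rw [hxs, sub_zero] at this
    refine this.trans ?_
    rw [← Real.rpow_natCast]
    calc C * e ^ ((2 : ℕ) : ℝ) ≤ max C 0 * e ^ ((2 : ℕ) : ℝ) := by
          gcongr; exact le_max_left _ _
      _ ≤ max C 0 * e ^ (1 + R.γ) := by
          gcongr ?_ * ?_
          rcases he0.eq_or_lt with h0 | h0
          · rw [← h0, Real.zero_rpow (by norm_num), Real.zero_rpow (by positivity)]
          · exact Real.rpow_le_rpow_of_exponent_ge h0 hx1.le (by push_cast; linarith)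
  have h2 : ‖H d + F x‖ ≤ L ^ (1 + R.γ) * e ^ (1 + R.γ) := by
    refine (hd.2.trans (min_le_right _ _)).trans ?_
    rw [← Real.mul_rpow hL0.le he0]
    have := hL x xs
    rw [hxs, sub_zero] at this
    gcongr
  have h3 : ‖H (x + d - xs)‖ ≤ (max C 0 + L ^ (1 + R.γ)) * e ^ (1 + R.γ) := by
    -- `H` maps the new error to the residual of the linear system minus the semismoothness
    -- remainder; coercivity then inverts `H`.
    have e1 : H (x + d - xs) = (H d + F x) - (F x - H (x - xs)) := by
      rw [add_sub_right_comm, map_add]; abel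
    rw [e1]
    exact (norm_sub_le _ _).trans (by linarith)
  have h4 : κ * ‖x + d - xs‖ ≤ ‖H (x + d - xs)‖ := by
    have h5 := (h.coercive x H hH (x + d - xs)).trans (real_inner_le_norm _ _)
    rcases (norm_nonneg (x + d - xs)).eq_or_lt with h0 | h0
    · rw [← h0]; simp
    · exact le_of_mul_le_mul_left (by nlinarith) h0
  rw [div_mul_eq_mul_div, le_div_iff₀ hκ]
  linarith

/-- Near the solution the full Newton step passes the Armijo test. -/
theorem eventually_unit_step (hκ : 0 < κ) (h : IsSC1 κ f F J) (R : SSNParams) {xs : E}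
    (hxs : F xs = 0) : ∀ᶠ x in 𝓝 xs, ∀ H ∈ J x, ∀ d,
      IsInexactDirection R.ηbar R.γ H (F x) d → f (x + d) ≤ f x + R.μ * inner ℝ (F x) d := by
  obtain ⟨L, hL0, hL, -⟩ := h.exists_lip
  obtain ⟨c, hc, herr⟩ := h.exists_newton_error hκ R hxs
  obtain ⟨C, hC⟩ := h.trapezoid xs
  have hγ := R.γ_mem.1
  have hμ := R.μ_mem.1
  have hμ2 : 0 < 1 / 2 - R.μ := by linarith [R.μ_mem.2]
  -- The three terms, in units of ‖x - xs‖², are the value left after the full step, the trapezoidal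
  -- error, and the error from replacing d by xs - x in the slope. The gap 1/2 - μ has to absorb
  -- them.
  have hsmall : ∀ᶠ x in 𝓝 xs, L * (c * ‖x - xs‖ ^ R.γ) ^ 2 + C * ‖x - xs‖
      + R.μ * L * (c * ‖x - xs‖ ^ R.γ) < (1 / 2 - R.μ) * κ := by
    have hn : Tendsto (fun x => ‖x - xs‖) (𝓝 xs) (𝓝 0) := by
      have : Continuous fun x => ‖x - xs‖ := by fun_prop
      simpa using this.tendsto xs
    have hr : Tendsto (fun x => ‖x - xs‖ ^ R.γ) (𝓝 xs) (𝓝 0) := by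
      have := hn.rpow_const (p := R.γ) (Or.inr hγ.le)
      rwa [Real.zero_rpow hγ.ne'] at this
    have := ((((hr.const_mul c).pow 2).const_mul L).add (hn.const_mul C)).add
      ((hr.const_mul c).const_mul (R.μ * L))
    refine this.eventually_lt_const ?_
    simp only [mul_zero, add_zero, ne_eq, OfNat.ofNat_ne_zero, not_false_eq_true, zero_pow]
    positivity
  filter_upwards [herr, hC, hsmall] with x hx hxC hxs' H hH d hd
  have hd1 := hx H hH d hd
  set e := ‖x - xs‖ with he
  have he0 : 0 ≤ e := norm_nonneg _
  set a := c * e ^ R.γ with ha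
  have ha0 : 0 ≤ a := by positivity
  have hd2 : ‖x + d - xs‖ ≤ a * e := by
    refine hd1.trans (le_of_eq ?_)
    rw [Real.rpow_add_of_nonneg he0 zero_le_one hγ.le, Real.rpow_one, ha]; ring
  have h1 := h.upper hκ.le hL xs (x + d)
  rw [hxs, inner_zero_left, add_zero] at h1
  have h2 : L * ‖x + d - xs‖ ^ 2 ≤ L * (a * e) ^ 2 := by gcongr
  rw [hxs, add_zero] at hxC
  have h3 := (abs_le.1 hxC).1
  have h4 := h.monotone x xs
  rw [hxs, sub_zero] at h4
  have hFx : ‖F x‖ ≤ L * e := by simpa [hxs] using hL x xs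
  have h5 : inner ℝ (F x) d = - inner ℝ (F x) (x - xs) + inner ℝ (F x) (x + d - xs) := by
    rw [← inner_neg_right, ← inner_add_right]; congr 1; abel
  have h6 : - (L * e * (a * e)) ≤ inner ℝ (F x) (x + d - xs) := by
    have h7 := (abs_le.1 (abs_real_inner_le_norm (F x) (x + d - xs))).1
    have : ‖F x‖ * ‖x + d - xs‖ ≤ L * e * (a * e) := by gcongr
    linarith
  have h8 : (L * a ^ 2 + C * e + R.μ * L * a) * e ^ 2 ≤ (1 / 2 - R.μ) * κ * e ^ 2 := by
    gcongr
  have h9 : (1 / 2 - R.μ) * (κ * e ^ 2) ≤ (1 / 2 - R.μ) * inner ℝ (F x) (x - xs) := by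
    gcongr
  have h10 := mul_le_mul_of_nonneg_left h6 hμ.le
  rw [h5]
  nlinarith

theorem rate_of_newtonStep (hκ : 0 < κ) (h : IsSC1 κ f F J) (R : SSNParams) {xs : E}
    (hxs : F xs = 0) {x : ℕ → E} (hx : ∀ j, NewtonStep R f F J (x j) (x (j + 1))) :
    ∃ c : ℝ, ∃ j₀ : ℕ, ∀ j ≥ j₀, ‖x (j + 1) - xs‖ ≤ c * ‖x j - xs‖ ^ (1 + R.γ) := by
  obtain ⟨c, -, herr⟩ := h.exists_newton_error hκ R hxs
  have hev := (h.tendsto_of_newtonStep hκ R hxs hx).eventually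
    (herr.and (h.eventually_unit_step hκ R hxs))
  obtain ⟨j₀, hj₀⟩ := eventually_atTop.1 hev
  refine ⟨c, j₀, fun j hj => ?_⟩
  obtain ⟨H, hH, d, hd, i, hi, hstep⟩ := hx j
  have hi0 : i = 0 := by
    have : i ≤ 0 := hi.2 (by simpa using (hj₀ j hj).2 H hH d hd)
    omega
  rw [hstep, hi0, pow_zero, one_smul]
  exact (hj₀ j hj).1 H hH d hd

end IsSC1

end Newton

/-! ### Orthogonality and finite termination of the preconditioned conjugate gradient method. -/

section ConjugateGradient

variable {E : Type*} [NormedAddCommGroup E] [InnerProductSpace ℝ E]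

theorem IsSPD.inner_self_eq_zero {H : E →L[ℝ] E} (hH : IsSPD H) {a : E} :
    inner ℝ a (H a) = 0 ↔ a = 0 := by
  refine ⟨fun h => ?_, fun h => by simp [h]⟩
  by_contra ha
  exact (hH.2 a ha).ne' h

theorem IsSPD.exists_solution [FiniteDimensional ℝ E] {H : E →L[ℝ] E} (hH : IsSPD H) (b : E) :
    ∃ d, H d = b := by
  have hinj : Function.Injective (H : E →ₗ[ℝ] E) := by
    rw [← LinearMap.ker_eq_bot, LinearMap.ker_eq_bot']
    intro a ha
    rw [← hH.inner_self_eq_zero]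
    have : H a = 0 := ha
    rw [this, inner_zero_right]
  exact LinearMap.injective_iff_surjective.1 hinj b

/-- The residual of the conjugate gradient method is the residual of its approximation. -/
theorem pcg_residual (H P : E →L[ℝ] E) (b : E) (k : ℕ) :
    (pcg H P b k).r = b - H (pcg H P b k).d := by
  induction k with
  | zero => simp [pcg]
  | succ k ih =>
    simp only [pcg, map_add, map_smul]
    rw [ih]; abel

/-- The orthogonality relations of the conjugate gradient method. -/
structure PCGInvariant (H P : E →L[ℝ] E) (b : E) (k : ℕ) : Prop where
  conj : ∀ i < k, inner ℝ (pcg H P b i).q (H (pcg H P b k).q) = 0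
  orth : ∀ i < k, inner ℝ (pcg H P b k).r (pcg H P b i).q = 0
  res : ∀ i < k, inner ℝ (pcg H P b k).r (P (pcg H P b i).r) = 0
  self : inner ℝ (pcg H P b k).r (pcg H P b k).q =
    inner ℝ (pcg H P b k).r (P (pcg H P b k).r)
  orth_d : inner ℝ (pcg H P b k).r (pcg H P b k).d = 0
  zero_iff : (pcg H P b k).q = 0 ↔ (pcg H P b k).r = 0

/-- The last clause is the dual form of the fact that the iterate lies in the span of the earlier
search directions; with `orth` it yields `orth_d`. The relations also cover the steps after
termination, where the direction is zero by `zero_iff`. -/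
theorem pcgInvariant {H P : E →L[ℝ] E} (hH : IsSPD H) (hP : IsSPD P) (b : E) (k : ℕ) :
    (∀ i ≤ k, PCGInvariant H P b i) ∧
      ∀ e, (∀ i < k, inner ℝ e (pcg H P b i).q = 0) → inner ℝ e (pcg H P b k).d = 0 := by
  induction k with
  | zero =>
    refine ⟨fun i hi => ?_, fun e _ => by simp [pcg]⟩
    obtain rfl : i = 0 := by omega
    refine ⟨by simp, by simp, by simp, by simp [pcg], by simp [pcg], ?_⟩
    simp only [pcg]
    refine ⟨fun h => ?_, fun h => by simp [h]⟩
    rw [← hP.inner_self_eq_zero, h, inner_zero_right]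
  | succ k ih =>
    obtain ⟨ih, ihd⟩ := ih
    have hk := ih k le_rfl
    have hspan : ∀ e, (∀ i < k + 1, inner ℝ e (pcg H P b i).q = 0) →
        inner ℝ e (pcg H P b (k + 1)).d = 0 := by
      intro e he
      simp only [pcg, inner_add_right, inner_smul_right]
      rw [ihd e fun i hi => he i (by omega), he k (by omega)]
      simp
    refine ⟨fun i hi => ?_, hspan⟩
    rcases Nat.lt_or_eq_of_le hi with hi | rfl
    · exact ih i (by omega)
    have hr : ∀ i, (pcg H P b (i + 1)).r = (pcg H P b i).r -
        (inner ℝ (pcg H P b i).r (P (pcg H P b i).r) /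
          inner ℝ (pcg H P b i).q (H (pcg H P b i).q)) • H (pcg H P b i).q := fun i => rfl
    have hq : ∀ i, (pcg H P b (i + 1)).q = P (pcg H P b (i + 1)).r +
        (inner ℝ (pcg H P b (i + 1)).r (P (pcg H P b (i + 1)).r) /
          inner ℝ (pcg H P b i).r (P (pcg H P b i).r)) • (pcg H P b i).q := fun i => rfl
    have hres0 : ∀ i ≤ k, (pcg H P b i).q ≠ 0 →
        inner ℝ (pcg H P b i).r (P (pcg H P b i).r) ≠ 0 := by
      intro i hi h0
      rw [ne_eq, hP.inner_self_eq_zero, ← (ih i hi).zero_iff]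
      exact h0
    have horth : ∀ i < k + 1, inner ℝ (pcg H P b (k + 1)).r (pcg H P b i).q = 0 := by
      intro i hi
      rw [hr, inner_sub_left, inner_smul_left, RCLike.conj_to_real]
      rcases Nat.lt_succ_iff_lt_or_eq.1 hi with hi | rfl
      · rw [hk.orth i hi, real_inner_comm (pcg H P b i).q (H _), hk.conj i hi]; simp
      · by_cases h0 : (pcg H P b i).q = 0
        · simp [h0]
        · have : inner ℝ (pcg H P b i).q (H (pcg H P b i).q) ≠ 0 := by
            rwa [ne_eq, hH.inner_self_eq_zero]
          rw [hk.self, real_inner_comm (pcg H P b i).q (H _), div_mul_cancel₀ _ this, sub_self]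
    have hres : ∀ i < k + 1, inner ℝ (pcg H P b (k + 1)).r (P (pcg H P b i).r) = 0 := by
      intro i hi
      rcases i with _ | i
      · exact horth 0 hi
      · have h1 := horth (i + 1) hi
        rw [hq, inner_add_right, inner_smul_right, horth i (by omega)] at h1
        simpa using h1
    have hself : inner ℝ (pcg H P b (k + 1)).r (pcg H P b (k + 1)).q =
        inner ℝ (pcg H P b (k + 1)).r (P (pcg H P b (k + 1)).r) := by
      rw [hq, inner_add_right, inner_smul_right, horth k (by omega)]; simp
    refine ⟨fun i hi => ?_, horth, hres, hself, hspan _ horth, fun h0 => ?_, fun h0 => ?_⟩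
    · by_cases h0 : (pcg H P b i).q = 0
      · simp [h0]
      have hrr := hres0 i (by omega) h0
      have hqq : inner ℝ (pcg H P b i).q (H (pcg H P b i).q) ≠ 0 := by
        rwa [ne_eq, hH.inner_self_eq_zero]
      -- The recurrence for the residual expresses the product of `q i` with `H (P r')`, where r' is
      -- the new residual, through products of residuals. These vanish for i < k; for i = k the one
      -- that remains cancels against the coefficient of `q k`.
      have h1 : inner ℝ (pcg H P b (i + 1)).r (P (pcg H P b (k + 1)).r) =
          inner ℝ (pcg H P b i).r (P (pcg H P b (k + 1)).r) -
          (inner ℝ (pcg H P b i).r (P (pcg H P b i).r) /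
          inner ℝ (pcg H P b i).q (H (pcg H P b i).q)) *
            inner ℝ (pcg H P b i).q (H (P (pcg H P b (k + 1)).r)) := by
        rw [hr i, inner_sub_left, inner_smul_left, RCLike.conj_to_real, hH.1]
      have h2 : inner ℝ (pcg H P b i).r (P (pcg H P b (k + 1)).r) = 0 := by
        rw [← hP.1, real_inner_comm]; exact hres i hi
      rw [hq k, map_add, map_smul, inner_add_right, inner_smul_right]
      rcases Nat.lt_succ_iff_lt_or_eq.1 hi with hi' | rfl
      · have h3 : inner ℝ (pcg H P b (i + 1)).r (P (pcg H P b (k + 1)).r) = 0 := by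
          rw [← hP.1, real_inner_comm]; exact hres (i + 1) (by omega)
        rw [hk.conj i hi', mul_zero, add_zero]
        rw [h2, h3, zero_sub, eq_comm, neg_eq_zero] at h1
        exact (mul_eq_zero.1 h1).resolve_left (div_ne_zero hrr hqq)
      · rw [h2, zero_sub] at h1
        rw [h1]
        field_simp
        ring
    · rw [← hP.inner_self_eq_zero, ← hself, h0, inner_zero_right]
    · rw [hq, h0]; simp

/-- The residual is orthogonal to the iterate, so the slope identity of `IsInexactDirection` holds
for a truncated iteration as well. -/
theorem inner_pcg_d {H P : E →L[ℝ] E} (hH : IsSPD H) (hP : IsSPD P) (b : E) (k : ℕ) :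
    inner ℝ b (pcg H P b k).d = inner ℝ (pcg H P b k).d (H (pcg H P b k).d) := by
  have h := ((pcgInvariant hH hP b k).1 k le_rfl).orth_d
  rw [pcg_residual, inner_sub_left, sub_eq_zero] at h
  rw [h, real_inner_comm]

/-- The conjugate gradient method terminates with the exact solution. -/
theorem exists_pcg_eq [FiniteDimensional ℝ E] {H P : E →L[ℝ] E} (hH : IsSPD H) (hP : IsSPD P)
    (b : E) : ∃ k, H (pcg H P b k).d = b := by
  by_contra hne
  push Not at hne
  have hq : ∀ k, (pcg H P b k).q ≠ 0 := by
    intro k h0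
    rw [((pcgInvariant hH hP b k).1 k le_rfl).zero_iff, pcg_residual, sub_eq_zero] at h0
    exact hne k h0.symm
  have hlt : ∀ i j, i < j → inner ℝ (pcg H P b i).q (H (pcg H P b j).q) = 0 := fun i j hij =>
    ((pcgInvariant hH hP b j).1 j le_rfl).conj i hij
  -- Without termination there would be infinitely many nonzero H-conjugate, hence independent,
  -- directions.
  have hli : LinearIndependent ℝ fun k => (pcg H P b k).q := by
    refine LinearMap.linearIndependent_of_isOrthoᵢ
      (B := (innerₗ E).compl₂ (H : E →ₗ[ℝ] E)) ?_ ?_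
    · rw [LinearMap.isOrthoᵢ_def]
      intro i j hij
      rcases lt_or_gt_of_ne hij with h | h
      · exact hlt i j h
      · have := hlt j i h
        rw [← hH.1, real_inner_comm] at this
        exact this
    · intro i h0
      exact hq i (hH.inner_self_eq_zero.1 h0)
  have := hli.finite
  exact not_finite ℕ

end ConjugateGradient

/-! ### Sums, affine substitution and elementary examples for `IsSC1`. -/

namespace IsSC1

variable {E : Type*} [NormedAddCommGroup E] [InnerProductSpace ℝ E]

theorem sum {ι : Type*} (s : Finset ι) {f : ι → E → ℝ} {F : ι → E → E}
    {J : ι → E → Set (E →L[ℝ] E)} (h : ∀ i ∈ s, IsSC1 0 (f i) (F i) (J i)) :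
    IsSC1 0 (fun x => ∑ i ∈ s, f i x) (fun x => ∑ i ∈ s, F i x)
      (fun x => {H | ∃ K : ι → E →L[ℝ] E, (∀ i ∈ s, K i ∈ J i x) ∧ H = ∑ i ∈ s, K i}) where
  lower x y := by
    rw [sum_inner, zero_div, zero_mul, add_zero, ← Finset.sum_add_distrib]
    refine Finset.sum_le_sum fun i hi => ?_
    simpa using (h i hi).lower x y
  lip := by
    choose! L hL using fun i hi => (h i hi).lip
    refine ⟨∑ i ∈ s, L i, fun x y => ?_⟩
    rw [← Finset.sum_sub_distrib, Finset.sum_mul]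
    exact norm_sum_le_of_le _ fun i hi => hL i hi x y
  symm := by
    rintro x _ ⟨K, hK, rfl⟩ a b
    rw [_root_.sum_apply, _root_.sum_apply, sum_inner, inner_sum]
    exact Finset.sum_congr rfl fun i hi => (h i hi).symm x _ (hK i hi) a b
  coercive := by
    rintro x _ ⟨K, hK, rfl⟩ a
    rw [_root_.sum_apply, inner_sum, zero_mul]
    exact Finset.sum_nonneg fun i hi => by simpa using (h i hi).coercive x _ (hK i hi) a
  bound := by
    choose! L hL using fun i hi => (h i hi).bound
    refine ⟨∑ i ∈ s, L i, ?_⟩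
    rintro x _ ⟨K, hK, rfl⟩ a
    rw [_root_.sum_apply, Finset.sum_mul]
    exact norm_sum_le_of_le _ fun i hi => hL i hi x _ (hK i hi) a
  newton x₀ := by
    choose! C hC using fun i hi => (h i hi).newton x₀
    refine ⟨∑ i ∈ s, C i, ?_⟩
    filter_upwards [(Filter.eventually_all_finset s).2 hC] with x hx
    rintro _ ⟨K, hK, rfl⟩
    rw [_root_.sum_apply, ← Finset.sum_sub_distrib, ← Finset.sum_sub_distrib,
      Finset.sum_mul]
    exact norm_sum_le_of_le _ fun i hi => hx i hi _ (hK i hi)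
  trapezoid x₀ := by
    choose! C hC using fun i hi => (h i hi).trapezoid x₀
    refine ⟨∑ i ∈ s, C i, ?_⟩
    filter_upwards [(Filter.eventually_all_finset s).2 hC] with x hx
    rw [← Finset.sum_sub_distrib, ← Finset.sum_add_distrib, sum_inner, Finset.mul_sum,
      ← Finset.sum_sub_distrib, Finset.sum_mul]
    exact (Finset.abs_sum_le_sum_abs _ _).trans (Finset.sum_le_sum fun i hi => hx i hi)

theorem add {κ₁ κ₂ : ℝ} {f₁ f₂ : E → ℝ} {F₁ F₂ : E → E} {J₁ J₂ : E → Set (E →L[ℝ] E)}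
    (h₁ : IsSC1 κ₁ f₁ F₁ J₁) (h₂ : IsSC1 κ₂ f₂ F₂ J₂) :
    IsSC1 (κ₁ + κ₂) (fun x => f₁ x + f₂ x) (fun x => F₁ x + F₂ x)
      (fun x => {H | ∃ H₁ ∈ J₁ x, ∃ H₂ ∈ J₂ x, H = H₁ + H₂}) where
  lower x y := by
    rw [inner_add_left]
    linarith [h₁.lower x y, h₂.lower x y]
  lip := by
    obtain ⟨L₁, h₁⟩ := h₁.lip
    obtain ⟨L₂, h₂⟩ := h₂.lip
    refine ⟨L₁ + L₂, fun x y => ?_⟩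
    rw [add_sub_add_comm, add_mul]
    exact norm_add_le_of_le (h₁ x y) (h₂ x y)
  symm := by
    rintro x _ ⟨H₁, hH₁, H₂, hH₂, rfl⟩ a b
    rw [_root_.add_apply, _root_.add_apply, inner_add_left,
      inner_add_right, h₁.symm x H₁ hH₁, h₂.symm x H₂ hH₂]
  coercive := by
    rintro x _ ⟨H₁, hH₁, H₂, hH₂, rfl⟩ a
    rw [_root_.add_apply, inner_add_right]
    linarith [h₁.coercive x H₁ hH₁ a, h₂.coercive x H₂ hH₂ a]
  bound := by
    obtain ⟨L₁, h₁⟩ := h₁.bound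
    obtain ⟨L₂, h₂⟩ := h₂.bound
    refine ⟨L₁ + L₂, ?_⟩
    rintro x _ ⟨H₁, hH₁, H₂, hH₂, rfl⟩ a
    rw [_root_.add_apply, add_mul]
    exact norm_add_le_of_le (h₁ x H₁ hH₁ a) (h₂ x H₂ hH₂ a)
  newton x₀ := by
    obtain ⟨C₁, h₁⟩ := h₁.newton x₀
    obtain ⟨C₂, h₂⟩ := h₂.newton x₀
    refine ⟨C₁ + C₂, ?_⟩
    filter_upwards [h₁, h₂] with x hx₁ hx₂
    rintro _ ⟨H₁, hH₁, H₂, hH₂, rfl⟩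
    rw [_root_.add_apply, add_sub_add_comm, add_sub_add_comm, add_mul]
    exact norm_add_le_of_le (hx₁ H₁ hH₁) (hx₂ H₂ hH₂)
  trapezoid x₀ := by
    obtain ⟨C₁, h₁⟩ := h₁.trapezoid x₀
    obtain ⟨C₂, h₂⟩ := h₂.trapezoid x₀
    refine ⟨C₁ + C₂, ?_⟩
    filter_upwards [h₁, h₂] with x hx₁ hx₂
    rw [add_mul]
    refine le_trans (le_of_eq ?_) ((abs_add_le _ _).trans (add_le_add hx₁ hx₂))
    congr 1
    rw [add_add_add_comm, inner_add_left]
    ring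

/-- Pulling the operators back to a T* K T preserves every property, so no chain rule for Clarke
Jacobians is needed. -/
theorem comp {E' : Type*} [NormedAddCommGroup E'] [InnerProductSpace ℝ E'] [CompleteSpace E]
    [CompleteSpace E'] {f : E' → ℝ} {F : E' → E'} {J : E' → Set (E' →L[ℝ] E')}
    (h : IsSC1 0 f F J) {a : ℝ} (ha : 0 ≤ a) (T : E →L[ℝ] E') (c : E') :
    IsSC1 0 (fun x => a * f (T x + c)) (fun x => a • T.adjoint (F (T x + c)))
      (fun x => {H | ∃ K ∈ J (T x + c), H = a • T.adjoint ∘L K ∘L T}) where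
  lower x y := by
    have := h.lower (T x + c) (T y + c)
    rw [add_sub_add_right_eq_sub, ← map_sub, zero_div, zero_mul, add_zero] at this
    rw [inner_smul_left, ContinuousLinearMap.adjoint_inner_left, zero_div, zero_mul, add_zero,
      RCLike.conj_to_real, ← mul_add]
    exact mul_le_mul_of_nonneg_left this ha
  lip := by
    obtain ⟨L, hL⟩ := h.lip
    refine ⟨a * ‖T.adjoint‖ * max L 0 * ‖T‖, fun x y => ?_⟩
    rw [← smul_sub, ← map_sub, norm_smul, Real.norm_eq_abs, abs_of_nonneg ha, mul_assoc,
      mul_assoc, mul_assoc]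
    refine mul_le_mul_of_nonneg_left ((T.adjoint.le_opNorm _).trans ?_) ha
    refine mul_le_mul_of_nonneg_left ((hL _ _).trans ?_) (norm_nonneg _)
    rw [add_sub_add_right_eq_sub, ← map_sub]
    exact mul_le_mul (le_max_left _ _) (T.le_opNorm _) (norm_nonneg _) (le_max_right _ _)
  symm := by
    rintro x _ ⟨K, hK, rfl⟩ u v
    simp only [_root_.smul_apply, ContinuousLinearMap.comp_apply, inner_smul_left,
      inner_smul_right, ContinuousLinearMap.adjoint_inner_left,
      ContinuousLinearMap.adjoint_inner_right, RCLike.conj_to_real, h.symm _ K hK]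
  coercive := by
    rintro x _ ⟨K, hK, rfl⟩ u
    simp only [_root_.smul_apply, ContinuousLinearMap.comp_apply,
      inner_smul_right, ContinuousLinearMap.adjoint_inner_right, zero_mul]
    exact mul_nonneg ha (by simpa using h.coercive _ K hK (T u))
  bound := by
    obtain ⟨L, hL⟩ := h.bound
    refine ⟨a * ‖T.adjoint‖ * max L 0 * ‖T‖, ?_⟩
    rintro x _ ⟨K, hK, rfl⟩ u
    simp only [_root_.smul_apply, ContinuousLinearMap.comp_apply]
    rw [norm_smul, Real.norm_eq_abs, abs_of_nonneg ha, mul_assoc, mul_assoc, mul_assoc]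
    refine mul_le_mul_of_nonneg_left ((T.adjoint.le_opNorm _).trans ?_) ha
    refine mul_le_mul_of_nonneg_left ((hL _ K hK _).trans ?_) (norm_nonneg _)
    exact mul_le_mul (le_max_left _ _) (T.le_opNorm _) (norm_nonneg _) (le_max_right _ _)
  newton x₀ := by
    obtain ⟨C, hC⟩ := h.newton (T x₀ + c)
    have hcont : Continuous fun x => T x + c := by fun_prop
    refine ⟨a * ‖T.adjoint‖ * max C 0 * ‖T‖ ^ 2, ?_⟩
    filter_upwards [(hcont.tendsto x₀).eventually hC] with x hx
    rintro _ ⟨K, hK, rfl⟩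
    simp only [_root_.smul_apply, ContinuousLinearMap.comp_apply]
    have := hx K hK
    rw [add_sub_add_right_eq_sub, ← map_sub] at this
    rw [← smul_sub, ← smul_sub, ← map_sub, ← map_sub, norm_smul, Real.norm_eq_abs,
      abs_of_nonneg ha, mul_assoc, mul_assoc, mul_assoc]
    refine mul_le_mul_of_nonneg_left ((T.adjoint.le_opNorm _).trans ?_) ha
    refine mul_le_mul_of_nonneg_left (this.trans ?_) (norm_nonneg _)
    rw [← mul_pow]
    refine mul_le_mul (le_max_left _ _) ?_ (by positivity) (le_max_right _ _)
    gcongr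
    exact T.le_opNorm _
  trapezoid x₀ := by
    obtain ⟨C, hC⟩ := h.trapezoid (T x₀ + c)
    have hcont : Continuous fun x => T x + c := by fun_prop
    refine ⟨a * max C 0 * ‖T‖ ^ 3, ?_⟩
    filter_upwards [(hcont.tendsto x₀).eventually hC] with x hx
    rw [add_sub_add_right_eq_sub, ← map_sub] at hx
    rw [← smul_add, ← map_add, inner_smul_left, ContinuousLinearMap.adjoint_inner_left,
      RCLike.conj_to_real, mul_left_comm (1 / 2 : ℝ), ← mul_sub, ← mul_sub, abs_mul,
      abs_of_nonneg ha, mul_assoc, mul_assoc, ← mul_pow]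
    refine mul_le_mul_of_nonneg_left (hx.trans ?_) ha
    refine mul_le_mul (le_max_left _ _) ?_ (by positivity) (le_max_right _ _)
    gcongr
    exact T.le_opNorm _

theorem quadratic {κ : ℝ} (hκ : 0 ≤ κ) (p : E) :
    IsSC1 κ (fun x => κ / 2 * ‖x - p‖ ^ 2) (fun x => κ • (x - p))
      (fun _ => {κ • ContinuousLinearMap.id ℝ E}) where
  lower x y := by
    have e : y - p = (x - p) + (y - x) := by abel
    rw [e, norm_add_sq_real, inner_smul_left, RCLike.conj_to_real]
    linarith
  lip := ⟨κ, fun x y => by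
    rw [← smul_sub, sub_sub_sub_cancel_right, norm_smul, Real.norm_eq_abs, abs_of_nonneg hκ]⟩
  symm := by
    rintro x _ rfl a b
    simp [inner_smul_left, inner_smul_right]
  coercive := by
    rintro x _ rfl a
    simp [inner_smul_right]
  bound := ⟨κ, by
    rintro x _ rfl a
    simp [norm_smul, abs_of_nonneg hκ]⟩
  newton x₀ := by
    refine ⟨0, Eventually.of_forall fun x => ?_⟩
    rintro _ rfl
    simp [← smul_sub]
  trapezoid x₀ := by
    refine ⟨0, Eventually.of_forall fun x => ?_⟩
    rw [zero_mul, abs_nonpos_iff, ← smul_add, inner_smul_left, RCLike.conj_to_real,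
      ← sub_sub_sub_cancel_right x x₀ p]
    generalize x - p = u
    generalize x₀ - p = v
    rw [inner_add_left, inner_sub_right, inner_sub_right, real_inner_self_eq_norm_sq,
      real_inner_self_eq_norm_sq, real_inner_comm]
    ring

theorem affine (b : E) (c : ℝ) :
    IsSC1 0 (fun x => inner ℝ b x + c) (fun _ => b) (fun _ => {0}) where
  lower x y := by
    rw [inner_sub_right]; linarith
  lip := ⟨0, by simp⟩
  symm := by
    rintro x _ rfl; simp
  coercive := by
    rintro x _ rfl; simp
  bound := ⟨0, by rintro x _ rfl; simp⟩
  newton x₀ := by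
    refine ⟨0, Eventually.of_forall fun x => ?_⟩
    rintro _ rfl
    simp
  trapezoid x₀ := by
    refine ⟨0, Eventually.of_forall fun x => ?_⟩
    rw [zero_mul, abs_nonpos_iff, inner_add_left, inner_sub_right]
    ring

end IsSC1

/-! ### Proximal mappings and Moreau envelopes. -/

section Moreau

variable {E : Type*} [NormedAddCommGroup E]

/-- `P x` is the proximal point at `x` of the convex function which is `g` on `K` and `+∞` off
`K`; the last term of the inequality reflects the strong convexity of the Moreau objective. -/
structure IsProx (K : Set E) (g : E → ℝ) (P : E → E) : Prop where
  mem : ∀ x, P x ∈ K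
  le : ∀ x, ∀ z ∈ K,
    g (P x) + 1 / 2 * ‖P x - x‖ ^ 2 + 1 / 2 * ‖z - P x‖ ^ 2 ≤ g z + 1 / 2 * ‖z - x‖ ^ 2

namespace IsProx

variable {K : Set E} {g : E → ℝ} {P : E → E}

section Objective

variable {ν : ℝ} {f : E → EReal}

/-- `IsProx` is normalized to g = ν f, with no ν in the quadratic term; here the inequality is
rescaled and extended by `⊤` off `K`. -/
theorem moreauObjective_add_le (h : IsProx K g P) (hν : 0 < ν) (hf : ∀ z ∈ K, f z = ((1 / ν * g z : ℝ) : EReal))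
    (hf' : ∀ z ∉ K, f z = ⊤) (x z : E) :
    moreauObjective ν f x (P x) + ((1 / (2 * ν) * ‖z - P x‖ ^ 2 : ℝ) : EReal) ≤
      moreauObjective ν f x z := by
  unfold moreauObjective
  by_cases hz : z ∈ K
  · rw [hf _ (h.mem x), hf z hz, ← EReal.coe_add, ← EReal.coe_add, ← EReal.coe_add,
      EReal.coe_le_coe_iff]
    have := mul_le_mul_of_nonneg_left (h.le x z hz) (by positivity : 0 ≤ 1 / ν)
    refine le_trans (le_of_eq ?_) (this.trans (le_of_eq ?_)) <;> field_simp
  · rw [hf' z hz, EReal.top_add_coe]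
    exact le_top

theorem moreauObjective_prox (h : IsProx K g P)
    (hf : ∀ z ∈ K, f z = ((1 / ν * g z : ℝ) : EReal)) (x : E) :
    moreauObjective ν f x (P x) =
      ((1 / ν * (g (P x) + 1 / 2 * ‖P x - x‖ ^ 2) : ℝ) : EReal) := by
  rw [moreauObjective, hf _ (h.mem x), ← EReal.coe_add]
  congr 1
  ring

theorem moreauObjective_le (h : IsProx K g P) (hν : 0 < ν)
    (hf : ∀ z ∈ K, f z = ((1 / ν * g z : ℝ) : EReal)) (hf' : ∀ z ∉ K, f z = ⊤) (x z : E) :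
    moreauObjective ν f x (P x) ≤ moreauObjective ν f x z := by
  refine le_trans ?_ (h.moreauObjective_add_le hν hf hf' x z)
  exact le_add_of_nonneg_right (EReal.coe_nonneg.2 (by positivity))

theorem prox_eq (h : IsProx K g P) (hν : 0 < ν)
    (hf : ∀ z ∈ K, f z = ((1 / ν * g z : ℝ) : EReal)) (hf' : ∀ z ∉ K, f z = ⊤) :
    prox ν f = P := by
  funext x
  -- A minimizer exists, so `Classical.epsilon` returns some minimizer; strong convexity then forces
  -- it to be `P x`.
  have hs : ∀ z, moreauObjective ν f x (prox ν f x) ≤ moreauObjective ν f x z :=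
    Classical.epsilon_spec (p := fun y => ∀ z, moreauObjective ν f x y ≤ moreauObjective ν f x z)
      ⟨P x, h.moreauObjective_le hν hf hf' x⟩
  have h1 := (h.moreauObjective_add_le hν hf hf' x (prox ν f x)).trans (hs (P x))
  rw [h.moreauObjective_prox hf, ← EReal.coe_add, EReal.coe_le_coe_iff] at h1
  have h2 : ‖prox ν f x - P x‖ ^ 2 ≤ 0 := by
    have h3 : 0 < 1 / (2 * ν) := by positivity
    by_contra hc
    push Not at hc
    nlinarith [mul_pos h3 hc]
  exact sub_eq_zero.1 (norm_eq_zero.1 (pow_eq_zero_iff two_ne_zero |>.1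
    (le_antisymm h2 (sq_nonneg _))))

end Objective

theorem proj_eq (h : IsProx K (fun _ => 0) P) : proj K = P := by
  funext x
  have hmin : ∀ z ∈ K, ‖P x - x‖ ^ 2 + ‖z - P x‖ ^ 2 ≤ ‖z - x‖ ^ 2 := fun z hz => by
    linarith [h.le x z hz]
  have hs : proj K x ∈ K ∧ ∀ z ∈ K, ‖proj K x - x‖ ≤ ‖z - x‖ :=
    Classical.epsilon_spec (p := fun y => y ∈ K ∧ ∀ z ∈ K, ‖y - x‖ ≤ ‖z - x‖)
      ⟨P x, h.mem x, fun z hz => abs_le_of_sq_le_sq' (by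
        have := hmin z hz
        have h0 : 0 ≤ ‖z - P x‖ ^ 2 := by positivity
        linarith) (norm_nonneg _) |>.2⟩
  have h1 := hmin _ hs.1
  have h2 : ‖proj K x - x‖ ^ 2 ≤ ‖P x - x‖ ^ 2 := by
    gcongr; exact hs.2 _ (h.mem x)
  have h3 : ‖proj K x - P x‖ ^ 2 ≤ 0 := by linarith
  exact sub_eq_zero.1 (norm_eq_zero.1 (pow_eq_zero_iff two_ne_zero |>.1
    (le_antisymm h3 (sq_nonneg _))))

end IsProx

variable [InnerProductSpace ℝ E]

/-- The convex function with gradient `P`. -/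
def proxPotential (g : E → ℝ) (P : E → E) (x : E) : ℝ :=
  inner ℝ x (P x) - 1 / 2 * ‖P x‖ ^ 2 - g (P x)

theorem proxPotential_eq (g : E → ℝ) (P : E → E) (x : E) :
    proxPotential g P x = 1 / 2 * ‖x‖ ^ 2 - (g (P x) + 1 / 2 * ‖P x - x‖ ^ 2) := by
  rw [proxPotential, norm_sub_sq_real, real_inner_comm]; ring

namespace IsProx

variable {K : Set E} {g : E → ℝ} {P : E → E}

/-- This is the optimality of `P y` tested against `P x`. The extra square is what makes `P`
nonexpansive. -/
theorem potential_lower' (h : IsProx K g P) (x y : E) :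
    proxPotential g P x + inner ℝ (P x) (y - x) + 1 / 2 * ‖P x - P y‖ ^ 2 ≤
      proxPotential g P y := by
  have := h.le y (P x) (h.mem x)
  rw [proxPotential_eq, proxPotential_eq]
  rw [norm_sub_sq_real (P x) y] at this
  rw [norm_sub_sq_real (P x) x, inner_sub_right]
  linarith

theorem potential_lower (h : IsProx K g P) (x y : E) :
    proxPotential g P x + inner ℝ (P x) (y - x) ≤ proxPotential g P y :=
  le_trans (le_add_of_nonneg_right (by positivity)) (h.potential_lower' x y)

/-- Adding `potential_lower'` for both orders gives firm nonexpansiveness; Cauchy-Schwarz finishes.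
-/
theorem norm_sub_le (h : IsProx K g P) (x y : E) : ‖P x - P y‖ ≤ ‖x - y‖ := by
  have h1 := h.potential_lower' x y
  have h2 := h.potential_lower' y x
  have e : inner ℝ (P x) (y - x) = - inner ℝ (P x) (x - y) := by
    rw [← inner_neg_right, neg_sub]
  have h3 := real_inner_le_norm (P x - P y) (x - y)
  rw [e] at h1
  rw [norm_sub_rev] at h2
  rw [inner_sub_left] at h3
  rcases (norm_nonneg (P x - P y)).eq_or_lt with h0 | h0
  · rw [← h0]; exact norm_nonneg _
  · exact le_of_mul_le_mul_left (by nlinarith) h0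

/-- It turns each pair -M + ‖·‖²/(2σ) in the augmented Lagrangian into `proxPotential` divided by σ.
-/
theorem moreauEnv_eq {ν : ℝ} {f : E → EReal} (h : IsProx K g P) (hν : 0 < ν)
    (hf : ∀ z ∈ K, f z = ((1 / ν * g z : ℝ) : EReal)) (hf' : ∀ z ∉ K, f z = ⊤) (x : E) :
    moreauEnv ν f x = 1 / (2 * ν) * ‖x‖ ^ 2 - 1 / ν * proxPotential g P x := by
  have : ⨅ y, moreauObjective ν f x y = moreauObjective ν f x (P x) :=
    le_antisymm (iInf_le _ _) (le_iInf (h.moreauObjective_le hν hf hf' x))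
  rw [moreauEnv, this, h.moreauObjective_prox hf, EReal.toReal_coe, proxPotential_eq]
  field_simp
  ring

end IsProx

end Moreau

/-! ### Soft thresholding of the Euclidean norm. -/

section Shrink

variable {E : Type*} [NormedAddCommGroup E] [InnerProductSpace ℝ E]

/-- The proximal mapping of `ζ ‖·‖`. -/
def shrink (ζ : ℝ) (w : E) : E :=
  if ‖w‖ ≤ ζ then 0 else (1 - ζ / ‖w‖) • w

/-- The derivative of `w ↦ w - ζ w / ‖w‖`. -/
def shrinkDeriv (ζ : ℝ) (w : E) : E →L[ℝ] E :=
  (1 - ζ / ‖w‖) • ContinuousLinearMap.id ℝ E + (ζ / ‖w‖ ^ 3) • (innerSL ℝ w).smulRight w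

theorem shrinkDeriv_apply (ζ : ℝ) (w v : E) :
    shrinkDeriv ζ w v = (1 - ζ / ‖w‖) • v + (ζ / ‖w‖ ^ 3 * inner ℝ w v) • w := by
  simp [shrinkDeriv, smul_smul]

/-- The Clarke Jacobian of `shrink ζ` at `w`. -/
def shrinkJac (ζ : ℝ) (w : E) : Set (E →L[ℝ] E) :=
  {J | ∃ t : ℝ, 0 ≤ t ∧ t ≤ 1 ∧ (‖w‖ < ζ → t = 0) ∧ (ζ < ‖w‖ ∨ ζ = 0 → t = 1) ∧
    J = t • shrinkDeriv ζ w}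

theorem shrink_of_le {ζ : ℝ} {w : E} (h : ‖w‖ ≤ ζ) : shrink ζ w = 0 := if_pos h

theorem shrink_of_ge {ζ : ℝ} (hζ : 0 < ζ) {w : E} (h : ζ ≤ ‖w‖) :
    shrink ζ w = (1 - ζ / ‖w‖) • w := by
  rcases h.eq_or_lt with h | h
  · rw [shrink_of_le h.ge, ← h, div_self hζ.ne', sub_self, zero_smul]
  · exact if_neg (not_le.2 h)

@[simp]
theorem shrink_zero : shrink (0 : ℝ) = (id : E → E) := by
  funext w
  by_cases h : ‖w‖ ≤ 0
  · rw [shrink_of_le h, norm_le_zero_iff.1 h, id]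
  · rw [shrink, if_neg h, zero_div, sub_zero, one_smul, id]

@[simp]
theorem shrinkDeriv_zero (w : E) : shrinkDeriv 0 w = ContinuousLinearMap.id ℝ E := by
  ext v; simp [shrinkDeriv_apply]

/-- The optimality condition: `w - shrink ζ w` is a subgradient of ζ‖·‖ at `shrink ζ w`. It serves
both `isProx_shrink` and the version on the orthant. -/
theorem shrink_vi {ζ : ℝ} (hζ : 0 ≤ ζ) (w z : E) :
    0 ≤ ζ * (‖z‖ - ‖shrink ζ w‖) + inner ℝ (z - shrink ζ w) (shrink ζ w - w) := by
  by_cases h : ‖w‖ ≤ ζ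
  · rw [shrink_of_le h, norm_zero, sub_zero, sub_zero, zero_sub, inner_neg_right]
    have h1 := real_inner_le_norm z w
    nlinarith [norm_nonneg z]
  · have hw : ζ < ‖w‖ := not_le.1 h
    have hw0 : 0 < ‖w‖ := hζ.trans_lt hw
    rw [shrink, if_neg h]
    have ha : 0 ≤ 1 - ζ / ‖w‖ := by
      rw [sub_nonneg, div_le_one hw0]; exact hw.le
    have e1 : (1 - ζ / ‖w‖) • w - w = (- (ζ / ‖w‖)) • w := by module
    rw [e1, norm_smul, Real.norm_eq_abs, abs_of_nonneg ha, inner_smul_right, inner_sub_left,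
      inner_smul_left, RCLike.conj_to_real, real_inner_self_eq_norm_sq]
    have h1 := real_inner_le_norm z w
    have h2 : ζ / ‖w‖ * inner ℝ z w ≤ ζ / ‖w‖ * (‖z‖ * ‖w‖) := by gcongr
    have e2 : ζ / ‖w‖ * (‖z‖ * ‖w‖) = ζ * ‖z‖ := by field_simp
    have e3 : ζ / ‖w‖ * ((1 - ζ / ‖w‖) * ‖w‖ ^ 2) = ζ * ((1 - ζ / ‖w‖) * ‖w‖) := by field_simp
    nlinarith

theorem isProx_shrink {ζ : ℝ} (hζ : 0 ≤ ζ) :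
    IsProx Set.univ (fun z : E => ζ * ‖z‖) (shrink ζ) where
  mem _ := trivial
  le w z _ := by
    have h1 := shrink_vi hζ w z
    have e : z - w = (z - shrink ζ w) + (shrink ζ w - w) := by abel
    rw [e, norm_add_sq_real]
    linarith

theorem proxPotential_shrink_of_le {ζ : ℝ} {w : E} (h : ‖w‖ ≤ ζ) :
    proxPotential (fun z : E => ζ * ‖z‖) (shrink ζ) w = 0 := by
  simp [proxPotential, shrink_of_le h]

theorem proxPotential_shrink_of_ge {ζ : ℝ} (hζ : 0 < ζ) {w : E} (h : ζ ≤ ‖w‖) :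
    proxPotential (fun z : E => ζ * ‖z‖) (shrink ζ) w = 1 / 2 * (‖w‖ - ζ) ^ 2 := by
  have hw0 : 0 < ‖w‖ := hζ.trans_le h
  have ha : 0 ≤ 1 - ζ / ‖w‖ := by
    rw [sub_nonneg, div_le_one hw0]; exact h
  rw [proxPotential, shrink_of_ge hζ h, norm_smul, Real.norm_eq_abs, abs_of_nonneg ha,
    inner_smul_right, real_inner_self_eq_norm_sq]
  field_simp
  ring

/-- The defect in Cauchy-Schwarz is of second order in w - w₀; the remainder estimates below rest on
this. -/
theorem mul_norm_sub_inner_le (w w₀ : E) :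
    ‖w‖ * ‖w₀‖ - inner ℝ w w₀ ≤ 1 / 2 * ‖w - w₀‖ ^ 2 := by
  rw [norm_sub_sq_real]
  nlinarith [sq_nonneg (‖w‖ - ‖w₀‖)]

/-- The second derivative of ζ w/‖w‖ is of order ζ/‖w‖² ≤ 1/ζ. An explicit identity replaces
Taylor's formula, since the segment from w₀ to w may enter the ball of radius ζ. -/
theorem norm_shrink_newton_le {ζ : ℝ} (hζ : 0 < ζ) {w w₀ : E} (h : ζ ≤ ‖w‖) (h₀ : ζ ≤ ‖w₀‖) :
    ‖shrink ζ w - shrink ζ w₀ - shrinkDeriv ζ w (w - w₀)‖ ≤ 3 / ζ * ‖w - w₀‖ ^ 2 := by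
  rw [shrink_of_ge hζ h, shrink_of_ge hζ h₀, shrinkDeriv_apply]
  have hr : 0 < ‖w‖ := hζ.trans_le h
  have hr₀ : 0 < ‖w₀‖ := hζ.trans_le h₀
  have hN := mul_norm_sub_inner_le w w₀
  have hN' := real_inner_le_norm w w₀
  have hd := abs_norm_sub_norm_le w w₀
  rw [inner_sub_right, real_inner_self_eq_norm_sq]
  set r := ‖w‖
  set r₀ := ‖w₀‖
  set N := inner ℝ w w₀
  set e := ‖w - w₀‖ with he
  have he0 : 0 ≤ e := norm_nonneg _
  have key : (1 - ζ / r) • w - (1 - ζ / r₀) • w₀ -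
      ((1 - ζ / r) • (w - w₀) + (ζ / r ^ 3 * (r ^ 2 - N)) • w) =
      (ζ / r) • ((r - r₀) • (r⁻¹ • (w₀ - w) + ((r - r₀) / (r * r₀)) • w₀) -
        ((r * r₀ - N) / r ^ 2) • w) := by
    match_scalars <;> field_simp <;> ring
  rw [key, norm_smul, Real.norm_eq_abs, abs_of_pos (by positivity)]
  have h1 : ‖r⁻¹ • (w₀ - w) + ((r - r₀) / (r * r₀)) • w₀‖ ≤ 2 * e / r := by
    refine (norm_add_le _ _).trans ?_
    rw [norm_smul, norm_smul, norm_sub_rev, ← he, Real.norm_eq_abs, Real.norm_eq_abs, abs_div,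
      abs_of_pos (inv_pos.2 hr), abs_of_pos (mul_pos hr hr₀)]
    have e1 : |r - r₀| / (r * r₀) * ‖w₀‖ = |r - r₀| / r := by
      change |r - r₀| / (r * r₀) * r₀ = |r - r₀| / r
      field_simp
    rw [e1]
    have : |r - r₀| / r ≤ e / r := by gcongr
    calc r⁻¹ * e + |r - r₀| / r ≤ r⁻¹ * e + e / r := by gcongr
      _ = 2 * e / r := by ring
  have h2 : ‖((r * r₀ - N) / r ^ 2) • w‖ ≤ 1 / 2 * e ^ 2 / r := by
    rw [norm_smul, Real.norm_eq_abs, abs_of_nonneg (div_nonneg (by linarith) (by positivity))]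
    change (r * r₀ - N) / r ^ 2 * r ≤ _
    have e1 : (r * r₀ - N) / r ^ 2 * r = (r * r₀ - N) / r := by field_simp
    rw [e1]
    gcongr
  have h3 : ‖(r - r₀) • (r⁻¹ • (w₀ - w) + ((r - r₀) / (r * r₀)) • w₀) -
      ((r * r₀ - N) / r ^ 2) • w‖ ≤ 3 * e ^ 2 / r := by
    refine (norm_sub_le _ _).trans ?_
    rw [norm_smul, Real.norm_eq_abs]
    have : |r - r₀| * ‖r⁻¹ • (w₀ - w) + ((r - r₀) / (r * r₀)) • w₀‖ ≤ e * (2 * e / r) := by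
      gcongr
    have h4 : e * (2 * e / r) + 1 / 2 * e ^ 2 / r ≤ 3 * e ^ 2 / r := by
      have : 0 ≤ e ^ 2 / r := by positivity
      have e5 : e * (2 * e / r) + 1 / 2 * e ^ 2 / r = 5 / 2 * (e ^ 2 / r) := by ring
      rw [e5, mul_div_assoc]
      linarith
    linarith
  calc ζ / r * _ ≤ ζ / r * (3 * e ^ 2 / r) := by gcongr
    _ ≤ 1 * (3 * e ^ 2 / ζ) := by
        gcongr
        rw [div_le_one hr]; exact h
    _ = 3 / ζ * e ^ 2 := by ring

theorem abs_shrink_trapezoid_le {ζ : ℝ} (hζ : 0 < ζ) {w w₀ : E} (h : ζ ≤ ‖w‖) (h₀ : ζ ≤ ‖w₀‖) :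
    |proxPotential (fun z : E => ζ * ‖z‖) (shrink ζ) w -
      proxPotential (fun z : E => ζ * ‖z‖) (shrink ζ) w₀ -
      1 / 2 * inner ℝ (shrink ζ w + shrink ζ w₀) (w - w₀)| ≤ 1 / ζ * ‖w - w₀‖ ^ 3 := by
  rw [proxPotential_shrink_of_ge hζ h, proxPotential_shrink_of_ge hζ h₀, shrink_of_ge hζ h,
    shrink_of_ge hζ h₀]
  have hr : 0 < ‖w‖ := hζ.trans_le h
  have hr₀ : 0 < ‖w₀‖ := hζ.trans_le h₀
  have hN := mul_norm_sub_inner_le w w₀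
  have hN' := real_inner_le_norm w w₀
  have hd := abs_norm_sub_norm_le w w₀
  rw [inner_sub_right, inner_add_left, inner_add_left, inner_smul_left, inner_smul_left,
    inner_smul_left, inner_smul_left, RCLike.conj_to_real, RCLike.conj_to_real,
    real_inner_self_eq_norm_sq, real_inner_self_eq_norm_sq, real_inner_comm w w₀]
  set r := ‖w‖
  set r₀ := ‖w₀‖
  set N := inner ℝ w w₀
  set e := ‖w - w₀‖ with he
  have he0 : 0 ≤ e := norm_nonneg _
  -- The trapezoidal error factors: r₀ - r is of first order and r r₀ - N of second order.
  have key : 1 / 2 * (r - ζ) ^ 2 - 1 / 2 * (r₀ - ζ) ^ 2 - 1 / 2 * ((1 - ζ / r) * r ^ 2 +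
      (1 - ζ / r₀) * N - ((1 - ζ / r) * N + (1 - ζ / r₀) * r₀ ^ 2)) =
      1 / 2 * (ζ / r) * (1 / r₀) * (r₀ - r) * (r * r₀ - N) := by
    field_simp
    ring
  rw [key, abs_mul, abs_mul, abs_of_nonneg (a := r * r₀ - N) (by linarith), abs_sub_comm,
    abs_of_pos (by positivity)]
  calc 1 / 2 * (ζ / r) * (1 / r₀) * |r - r₀| * (r * r₀ - N)
      ≤ 1 / 2 * 1 * (1 / ζ) * e * (1 / 2 * e ^ 2) := by
        have : ζ / r ≤ 1 := by rw [div_le_one hr]; exact h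
        gcongr
    _ ≤ 1 / ζ * e ^ 3 := by
        have : 0 ≤ 1 / ζ * e ^ 3 := by positivity
        linarith

theorem norm_shrinkJac_le {ζ : ℝ} (hζ : 0 ≤ ζ) {w : E} {J : E →L[ℝ] E} (hJ : J ∈ shrinkJac ζ w)
    (v : E) : ‖J v‖ ≤ ‖v‖ := by
  obtain ⟨t, ht0, ht1, hlt, -, rfl⟩ := hJ
  rw [_root_.smul_apply, norm_smul, Real.norm_eq_abs, abs_of_nonneg ht0]
  by_cases hw : ‖w‖ < ζ
  · rw [hlt hw, zero_mul]; exact norm_nonneg _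
  push Not at hw
  have key : ‖shrinkDeriv ζ w v‖ ≤ ‖v‖ := by
    rw [shrinkDeriv_apply]
    rcases (norm_nonneg w).eq_or_lt with h0 | h0
    · rw [← h0]; simp
    · refine (norm_add_le _ _).trans ?_
      rw [norm_smul, norm_smul, norm_mul, Real.norm_eq_abs, Real.norm_eq_abs, Real.norm_eq_abs,
        abs_of_nonneg (a := 1 - ζ / ‖w‖) (by rw [sub_nonneg, div_le_one h0]; exact hw),
        abs_of_nonneg (a := ζ / ‖w‖ ^ 3) (by positivity)]
      have h1 : ζ / ‖w‖ ^ 3 * |inner ℝ w v| * ‖w‖ ≤ ζ / ‖w‖ ^ 3 * (‖w‖ * ‖v‖) * ‖w‖ := by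
        gcongr; exact abs_real_inner_le_norm w v
      have h2 : ζ / ‖w‖ ^ 3 * (‖w‖ * ‖v‖) * ‖w‖ = ζ / ‖w‖ * ‖v‖ := by field_simp
      linarith
  nlinarith [norm_nonneg (shrinkDeriv ζ w v)]

theorem shrink_newton {ζ : ℝ} (hζ : 0 ≤ ζ) (w₀ : E) : ∃ C, 0 ≤ C ∧ ∀ᶠ w in 𝓝 w₀,
    ∀ J ∈ shrinkJac ζ w, ‖shrink ζ w - shrink ζ w₀ - J (w - w₀)‖ ≤ C * ‖w - w₀‖ ^ 2 := by
  rcases hζ.eq_or_lt with rfl | hζ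
  · refine ⟨0, le_rfl, Eventually.of_forall fun w => ?_⟩
    rintro _ ⟨t, -, -, -, ht, rfl⟩
    simp [ht (Or.inr rfl)]
  refine ⟨3 / ζ, by positivity, ?_⟩
  have hpos : 0 ≤ 3 / ζ := by positivity
  rcases lt_trichotomy ‖w₀‖ ζ with h₀ | h₀ | h₀
  · filter_upwards [continuous_norm.continuousAt.eventually_lt_const h₀] with w hw
    rintro _ ⟨t, -, -, ht, -, rfl⟩
    rw [ht hw, shrink_of_le hw.le, shrink_of_le h₀.le]
    simp only [zero_smul, sub_zero, _root_.zero_apply, norm_zero]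
    positivity
  · refine Eventually.of_forall fun w => ?_
    rintro _ ⟨t, ht0, ht1, htl, htg, rfl⟩
    rcases lt_trichotomy ‖w‖ ζ with hw | hw | hw
    · rw [htl hw, shrink_of_le hw.le, shrink_of_le h₀.le]
      simp only [zero_smul, sub_zero, _root_.zero_apply, norm_zero]
      positivity
    -- The only case with free `t`. Both values of `shrink` vanish, so the remainder is `t` times
    -- the one for t = 1.
    · have := norm_shrink_newton_le hζ hw.ge h₀.ge
      rw [shrink_of_le hw.le, shrink_of_le h₀.le, sub_zero, zero_sub, norm_neg] at this ⊢
      rw [_root_.smul_apply, norm_smul, Real.norm_eq_abs, abs_of_nonneg ht0]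
      refine le_trans ?_ this
      exact mul_le_of_le_one_left (norm_nonneg _) ht1
    · rw [htg (Or.inl hw), one_smul]
      exact norm_shrink_newton_le hζ hw.le h₀.ge
  · filter_upwards [continuous_norm.continuousAt.eventually_const_lt h₀] with w hw
    rintro _ ⟨t, -, -, -, ht, rfl⟩
    rw [ht (Or.inl hw), one_smul]
    exact norm_shrink_newton_le hζ hw.le h₀.le

theorem shrink_trapezoid {ζ : ℝ} (hζ : 0 ≤ ζ) (w₀ : E) : ∃ C, 0 ≤ C ∧ ∀ᶠ w in 𝓝 w₀,
    |proxPotential (fun z : E => ζ * ‖z‖) (shrink ζ) w -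
      proxPotential (fun z : E => ζ * ‖z‖) (shrink ζ) w₀ -
      1 / 2 * inner ℝ (shrink ζ w + shrink ζ w₀) (w - w₀)| ≤ C * ‖w - w₀‖ ^ 3 := by
  rcases hζ.eq_or_lt with rfl | hζ
  · refine ⟨0, le_rfl, Eventually.of_forall fun w => ?_⟩
    rw [zero_mul, abs_nonpos_iff]
    simp only [proxPotential, shrink_zero, id, inner_add_left, inner_sub_right,
      real_inner_self_eq_norm_sq, real_inner_comm w w₀]
    ring
  refine ⟨1 / ζ, by positivity, ?_⟩
  have hzero : ∀ w : E, ‖w‖ ≤ ζ → ‖w₀‖ ≤ ζ →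
      |proxPotential (fun z : E => ζ * ‖z‖) (shrink ζ) w -
      proxPotential (fun z : E => ζ * ‖z‖) (shrink ζ) w₀ -
      1 / 2 * inner ℝ (shrink ζ w + shrink ζ w₀) (w - w₀)| ≤ 1 / ζ * ‖w - w₀‖ ^ 3 := by
    intro w hw h₀
    rw [proxPotential_shrink_of_le hw, proxPotential_shrink_of_le h₀, shrink_of_le hw,
      shrink_of_le h₀]
    simp only [sub_zero, add_zero, inner_zero_left, mul_zero, abs_zero]
    positivity
  rcases lt_trichotomy ‖w₀‖ ζ with h₀ | h₀ | h₀
  · filter_upwards [continuous_norm.continuousAt.eventually_lt_const h₀] with w hw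
    exact hzero w hw.le h₀.le
  · refine Eventually.of_forall fun w => ?_
    rcases le_total ‖w‖ ζ with hw | hw
    · exact hzero w hw h₀.le
    · exact abs_shrink_trapezoid_le hζ hw h₀.ge
  · filter_upwards [continuous_norm.continuousAt.eventually_const_lt h₀] with w hw
    exact abs_shrink_trapezoid_le hζ hw.le h₀.le

end Shrink

/-! ### Clarke Jacobians, and that of soft thresholding. -/

section Clarke

variable {E : Type*} [NormedAddCommGroup E] [InnerProductSpace ℝ E]

/-- Pointwise convergence of the derivatives is all that is kept, so limits can be computed vector
by vector. -/
theorem clarkeJacobian_subset {f : E → E} {x : E} {K : Set (E →L[ℝ] E)} (hK : Convex ℝ K)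
    (h : ∀ (s : ℕ → E) (L : E →L[ℝ] E), Tendsto s atTop (𝓝 x) →
      (∀ k, DifferentiableAt ℝ f (s k)) →
      (∀ v, Tendsto (fun k => fderiv ℝ f (s k) v) atTop (𝓝 (L v))) → L ∈ K) :
    clarkeJacobian f x ⊆ K := by
  refine convexHull_min ?_ hK
  rintro L ⟨s, hs, hd, hL⟩
  exact h s L hs hd fun v =>
    ((ContinuousLinearMap.apply ℝ E v).continuous.tendsto L).comp hL

/-- Rademacher's theorem gives points of differentiability tending to x; their derivatives lie in
the compact unit ball. -/
theorem clarkeJacobian_nonempty [FiniteDimensional ℝ E] {f : E → E}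
    (hf : ∀ x y, ‖f x - f y‖ ≤ ‖x - y‖) (x : E) : (clarkeJacobian f x).Nonempty := by
  let _ : MeasurableSpace E := borel E
  have : BorelSpace E := ⟨rfl⟩
  have hlip : LipschitzWith 1 f := LipschitzWith.of_dist_le_mul fun a b => by
    simpa [dist_eq_norm] using hf a b
  have hdense : Dense {y | DifferentiableAt ℝ f y} :=
    MeasureTheory.Measure.dense_of_ae
      (hlip.ae_differentiableAt (μ := MeasureTheory.Measure.addHaar))
  obtain ⟨s, hs, hsx⟩ := mem_closure_iff_seq_limit.1 (hdense x)
  have hb : ∀ k, fderiv ℝ f (s k) ∈ Metric.closedBall (0 : E →L[ℝ] E) 1 := fun k => by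
    rw [mem_closedBall_zero_iff]
    simpa using norm_fderiv_le_of_lipschitz ℝ hlip (x₀ := s k)
  obtain ⟨L, -, φ, hφ, hL⟩ := (isCompact_closedBall (0 : E →L[ℝ] E) 1).tendsto_subseq hb
  exact ⟨L, subset_convexHull ℝ _
    ⟨s ∘ φ, hsx.comp hφ.tendsto_atTop, fun k => hs (φ k), hL⟩⟩

theorem clarkeJacobian_zero_subset (x : E) : clarkeJacobian (fun _ : E => (0 : E)) x ⊆ {0} := by
  refine clarkeJacobian_subset (convex_singleton 0) fun s L _ _ hL => ?_
  ext v
  refine tendsto_nhds_unique (hL v) ?_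
  simp

theorem not_differentiableAt_max_zero : ¬ DifferentiableAt ℝ (fun t : ℝ => max t 0) 0 := by
  intro h
  refine not_differentiableAt_abs_zero ?_
  have h1 : DifferentiableAt ℝ (fun t : ℝ => 2 * max t 0 - t) 0 :=
    (h.const_mul 2).sub differentiableAt_id
  convert h1 using 2 with t
  rcases le_total t 0 with ht | ht
  · rw [abs_of_nonpos ht, max_eq_right ht]; ring
  · rw [abs_of_nonneg ht, max_eq_left ht]; ring

theorem hasFDerivAt_shrink {ζ : ℝ} (hζ : 0 ≤ ζ) {w : E} (h : ζ < ‖w‖ ∨ ζ = 0) :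
    HasFDerivAt (shrink ζ) (shrinkDeriv ζ w) w := by
  rcases hζ.eq_or_lt with rfl | hζ
  · rw [shrink_zero, shrinkDeriv_zero]
    exact hasFDerivAt_id w
  have hw := h.resolve_right hζ.ne'
  refine hasFDerivAt_of_quadratic_bound (C := 3 / ζ) ?_
  filter_upwards [continuous_norm.continuousAt.eventually_const_lt hw] with y hy
  have := norm_shrink_newton_le hζ hw.le hy.le
  rw [norm_sub_rev w y] at this
  refine le_trans (le_of_eq ?_) this
  rw [← norm_neg, ← neg_sub y w, map_neg]
  congr 1
  abel

theorem hasFDerivAt_shrink_of_lt {ζ : ℝ} {w : E} (h : ‖w‖ < ζ) :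
    HasFDerivAt (shrink ζ) (0 : E →L[ℝ] E) w := by
  refine (hasFDerivAt_const (0 : E) w).congr_of_eventuallyEq ?_
  filter_upwards [continuous_norm.continuousAt.eventually_lt_const h] with y hy
  exact shrink_of_le hy.le

/-- Along the ray through w the radial component has the kink of max(t, 0). This keeps the sphere of
radius ζ out of the sequences which define the Clarke Jacobian. -/
theorem not_differentiableAt_shrink {ζ : ℝ} (hζ : 0 < ζ) {w : E} (h : ‖w‖ = ζ) :
    ¬ DifferentiableAt ℝ (shrink ζ) w := by
  intro hd
  have h1 : DifferentiableAt ℝ (fun t : ℝ => inner ℝ w (shrink ζ (w + t • w)) / ζ ^ 2) 0 := by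
    have hline : DifferentiableAt ℝ (fun t : ℝ => w + t • w) 0 := by fun_prop
    have hd' : DifferentiableAt ℝ (shrink ζ) (w + (0 : ℝ) • w) := by simpa using hd
    have := hd'.comp (0 : ℝ) hline
    exact (((innerSL ℝ w).differentiableAt).comp (0 : ℝ) this).div_const _
  refine not_differentiableAt_max_zero (h1.congr_of_eventuallyEq ?_)
  filter_upwards [eventually_gt_nhds (by norm_num : (-1 : ℝ) < 0)] with t ht
  have e : w + t • w = (1 + t) • w := by module
  have hn : ‖w + t • w‖ = (1 + t) * ζ := by
    rw [e, norm_smul, h, Real.norm_eq_abs, abs_of_pos (by linarith)]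
  rcases le_total t 0 with ht0 | ht0
  · rw [max_eq_right ht0, shrink_of_le, inner_zero_right, zero_div]
    rw [hn]; nlinarith
  · have h1t : 0 < 1 + t := by linarith
    rw [max_eq_left ht0, shrink_of_ge hζ, hn, e, smul_smul, inner_smul_right,
      real_inner_self_eq_norm_sq, h]
    · field_simp
      ring
    · rw [hn]; nlinarith

theorem convex_shrinkJac (ζ : ℝ) (w : E) : Convex ℝ (shrinkJac ζ w) := by
  rintro _ ⟨t, ht0, ht1, htl, htg, rfl⟩ _ ⟨u, hu0, hu1, hul, hug, rfl⟩ a b ha hb hab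
  refine ⟨a * t + b * u, by positivity, by nlinarith, fun h => ?_, fun h => ?_, ?_⟩
  · rw [htl h, hul h]; ring
  · rw [htg h, hug h]; linarith
  · module

theorem tendsto_shrinkDeriv {ζ : ℝ} {w : E} (hw : ζ = 0 ∨ w ≠ 0) (v : E) :
    Tendsto (fun s => shrinkDeriv ζ s v) (𝓝 w) (𝓝 (shrinkDeriv ζ w v)) := by
  rcases hw with rfl | hw
  · simp
  · have hn : ‖w‖ ≠ 0 := norm_ne_zero_iff.2 hw
    simp only [shrinkDeriv_apply]
    have : ContinuousAt (fun s : E => (1 - ζ / ‖s‖) • v + (ζ / ‖s‖ ^ 3 * inner ℝ s v) • s) w := by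
      fun_prop (disch := positivity)
    exact this

theorem clarkeJacobian_shrink_subset {ζ : ℝ} (hζ : 0 ≤ ζ) (w : E) :
    clarkeJacobian (shrink ζ) w ⊆ shrinkJac ζ w := by
  refine clarkeJacobian_subset (convex_shrinkJac ζ w) fun s L hs hd hL => ?_
  rcases hζ.eq_or_lt with rfl | hζ
  · refine ⟨1, zero_le_one, le_rfl, fun h => absurd h (not_lt.2 (norm_nonneg _)),
      fun _ => rfl, ?_⟩
    ext v
    refine tendsto_nhds_unique (hL v) ?_
    simp
  have hlt : ∀ k, ‖s k‖ < ζ → fderiv ℝ (shrink ζ) (s k) = 0 := fun k hk =>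
    (hasFDerivAt_shrink_of_lt hk).fderiv
  have hgt : ∀ k, ζ < ‖s k‖ → fderiv ℝ (shrink ζ) (s k) = shrinkDeriv ζ (s k) := fun k hk =>
    (hasFDerivAt_shrink hζ.le (Or.inl hk)).fderiv
  have hne : ∀ k, ‖s k‖ ≠ ζ := fun k hk => not_differentiableAt_shrink hζ hk (hd k)
  have hzero : (∃ᶠ k in atTop, ‖s k‖ < ζ) → L = 0 := by
    intro hfr
    ext v
    exact isClosed_singleton.mem_of_frequently_of_tendsto
      (hfr.mono fun k hk => show _ ∈ ({0} : Set E) by simp [hlt k hk]) (hL v)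
  have hder : (∀ᶠ k in atTop, ζ < ‖s k‖) → w ≠ 0 → L = shrinkDeriv ζ w := by
    intro hev hw
    ext v
    refine tendsto_nhds_unique (hL v) (((tendsto_shrinkDeriv (Or.inr hw) v).comp hs).congr' ?_)
    filter_upwards [hev] with k hk
    rw [hgt k hk, Function.comp]
  have hns := hs.norm
  rcases lt_trichotomy ‖w‖ ζ with hw | hw | hw
  · refine ⟨0, le_rfl, zero_le_one, fun _ => rfl, fun h => ?_, ?_⟩
    · rcases h with h | h <;> linarith
    · rw [zero_smul]
      exact hzero (hns.eventually_lt_const hw).frequently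
  -- On the sphere, a sequence that meets the open ball infinitely often has limit derivative 0; any
  -- other is eventually outside.
  · by_cases hfr : ∃ᶠ k in atTop, ‖s k‖ < ζ
    · refine ⟨0, le_rfl, zero_le_one, fun _ => rfl, fun h => ?_, ?_⟩
      · rcases h with h | h <;> linarith
      · rw [zero_smul]
        exact hzero hfr
    · rw [not_frequently] at hfr
      refine ⟨1, zero_le_one, le_rfl, fun h => absurd hw h.ne, fun _ => rfl, ?_⟩
      rw [one_smul]
      refine hder (hfr.mono fun k hk => lt_of_le_of_ne (not_lt.1 hk) (hne k).symm) ?_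
      rw [← norm_ne_zero_iff]; linarith
  · refine ⟨1, zero_le_one, le_rfl, fun h => absurd hw h.not_gt, fun _ => rfl, ?_⟩
    rw [one_smul]
    refine hder (hns.eventually_const_lt hw) ?_
    rw [← norm_ne_zero_iff]; linarith

end Clarke

/-! ### Projection onto the nonnegative orthant. -/

section Orthant

variable {ι : Type*}

/-- The projection onto the nonnegative orthant. -/
def posVec (x : EuclideanSpace ℝ ι) : EuclideanSpace ℝ ι := WithLp.toLp 2 fun i => max (x i) 0

@[simp]
theorem posVec_apply (x : EuclideanSpace ℝ ι) (i : ι) : posVec x i = max (x i) 0 := rfl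

theorem posVec_mem (x : EuclideanSpace ℝ ι) : posVec x ∈ orthant ι := fun _ => le_max_right _ _

/-- The Clarke Jacobian of the projection onto the nonnegative orthant. -/
def posJac (x : EuclideanSpace ℝ ι) : Set (EuclideanSpace ℝ ι →L[ℝ] EuclideanSpace ℝ ι) :=
  {J | ∃ d : ι → ℝ, (∀ i, 0 ≤ d i ∧ d i ≤ 1 ∧ (0 < x i → d i = 1) ∧ (x i < 0 → d i = 0)) ∧
    ∀ v i, J v i = d i * v i}

/-- The reason why J₁ J₂ is self-adjoint: the rank-one part of J₁ is directed along `posVec x`,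
which J₂ fixes. -/
theorem posJac_posVec {x : EuclideanSpace ℝ ι} {J : EuclideanSpace ℝ ι →L[ℝ] EuclideanSpace ℝ ι}
    (hJ : J ∈ posJac x) : J (posVec x) = posVec x := by
  obtain ⟨d, hd, hJ⟩ := hJ
  ext i
  rw [hJ, posVec_apply]
  rcases le_or_gt (x i) 0 with h | h
  · rw [max_eq_right h, mul_zero]
  · rw [(hd i).2.2.1 h, one_mul]

variable [Fintype ι]

theorem inner_sub_posVec_nonneg {z : EuclideanSpace ℝ ι} (hz : z ∈ orthant ι)
    (x : EuclideanSpace ℝ ι) : 0 ≤ inner ℝ z (posVec x - x) := by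
  rw [PiLp.inner_apply]
  refine Finset.sum_nonneg fun i _ => ?_
  have h1 : 0 ≤ max (x i) 0 - x i := sub_nonneg.2 (le_max_left _ _)
  simpa using mul_nonneg h1 (hz i)

theorem inner_posVec_sub_eq (x : EuclideanSpace ℝ ι) : inner ℝ (posVec x) (posVec x - x) = 0 := by
  rw [PiLp.inner_apply]
  refine Finset.sum_eq_zero fun i _ => ?_
  rcases le_total (x i) 0 with h | h <;> simp [h]

theorem isProx_posVec : IsProx (orthant ι) (fun _ => 0) posVec where
  mem := posVec_mem
  le x z hz := by
    have e : z - x = (z - posVec x) + (posVec x - x) := by abel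
    have h1 := inner_sub_posVec_nonneg hz x
    have h2 := inner_posVec_sub_eq x
    rw [e, norm_add_sq_real, inner_sub_left]
    linarith

theorem isProx_zero {E : Type*} [NormedAddCommGroup E] :
    IsProx ({0} : Set E) (fun _ => 0) (fun _ => 0) where
  mem _ := rfl
  le x z hz := by
    rw [Set.mem_singleton_iff.1 hz]; simp

theorem convex_posJac (x : EuclideanSpace ℝ ι) : Convex ℝ (posJac x) := by
  rintro J ⟨d, hd, hJ⟩ K ⟨e, he, hK⟩ a b ha hb hab
  refine ⟨fun i => a * d i + b * e i, fun i => ?_, fun v i => ?_⟩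
  · obtain ⟨d0, d1, d2, d3⟩ := hd i
    obtain ⟨e0, e1, e2, e3⟩ := he i
    refine ⟨by positivity, by nlinarith, fun h => ?_, fun h => ?_⟩
    · simp only [d2 h, e2 h]; linarith
    · simp only [d3 h, e3 h]; ring
  · simp [hJ, hK]; ring

/-- At a point of differentiability no coordinate of `y` is zero, by the kink of max(t, 0); near `y`
each coordinate map is then linear. -/
theorem posVec_fderiv {y : EuclideanSpace ℝ ι} (hy : DifferentiableAt ℝ posVec y) (i : ι) :
    ∃ d : ℝ, 0 ≤ d ∧ d ≤ 1 ∧ (0 < y i → d = 1) ∧ (y i < 0 → d = 0) ∧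
      ∀ v, fderiv ℝ posVec y v i = d * v i := by
  classical
  have h1 : HasFDerivAt (fun x : EuclideanSpace ℝ ι => max (x i) 0)
      ((EuclideanSpace.proj i : EuclideanSpace ℝ ι →L[ℝ] ℝ) ∘L fderiv ℝ posVec y) y :=
    (EuclideanSpace.proj i : EuclideanSpace ℝ ι →L[ℝ] ℝ).hasFDerivAt.comp y hy.hasFDerivAt
  have hcont : ContinuousAt (fun x : EuclideanSpace ℝ ι => x i) y := by fun_prop
  rcases lt_trichotomy (y i) 0 with h | h | h
  · refine ⟨0, le_rfl, zero_le_one, fun h' => absurd h h'.not_gt, fun _ => rfl, fun v => ?_⟩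
    have h2 : HasFDerivAt (fun x : EuclideanSpace ℝ ι => max (x i) 0)
        (0 : EuclideanSpace ℝ ι →L[ℝ] ℝ) y := by
      refine (hasFDerivAt_const (0 : ℝ) y).congr_of_eventuallyEq ?_
      filter_upwards [hcont.eventually_lt_const h] with x hx
      exact max_eq_right hx.le
    simpa using DFunLike.congr_fun (h1.unique h2) v
  · exfalso
    have hline : DifferentiableAt ℝ (fun t : ℝ => y + t • EuclideanSpace.single i (1 : ℝ)) 0 := by
      fun_prop
    have h1' : DifferentiableAt ℝ (fun x : EuclideanSpace ℝ ι => max (x i) 0)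
        (y + (0 : ℝ) • EuclideanSpace.single i (1 : ℝ)) := by
      rw [zero_smul, add_zero]
      exact h1.differentiableAt
    have h2 := h1'.comp (0 : ℝ) hline
    refine not_differentiableAt_max_zero ?_
    have e : (fun t : ℝ => max t 0) = (fun x : EuclideanSpace ℝ ι => max (x i) 0) ∘
        fun t : ℝ => y + t • EuclideanSpace.single i (1 : ℝ) := by
      funext t; simp [h]
    rwa [e]
  · refine ⟨1, zero_le_one, le_rfl, fun _ => rfl, fun h' => absurd h h'.not_gt, fun v => ?_⟩
    have h2 : HasFDerivAt (fun x : EuclideanSpace ℝ ι => max (x i) 0)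
        (EuclideanSpace.proj i : EuclideanSpace ℝ ι →L[ℝ] ℝ) y := by
      refine (EuclideanSpace.proj i : EuclideanSpace ℝ ι →L[ℝ] ℝ).hasFDerivAt
        |>.congr_of_eventuallyEq ?_
      filter_upwards [hcont.eventually_const_lt h] with x hx
      exact max_eq_left hx.le
    simpa using DFunLike.congr_fun (h1.unique h2) v

theorem clarkeJacobian_posVec_subset (x : EuclideanSpace ℝ ι) :
    clarkeJacobian posVec x ⊆ posJac x := by
  classical
  refine clarkeJacobian_subset (convex_posJac x) fun s L hs hd hL => ?_
  choose d hd0 hd1 hdp hdn hdv using fun k i => posVec_fderiv (hd k) i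
  have hLi : ∀ v i, Tendsto (fun k => d k i * v i) atTop (𝓝 (L v i)) := fun v i => by
    have h1 : Continuous fun x : EuclideanSpace ℝ ι => x i := by fun_prop
    exact ((h1.tendsto (L v)).comp (hL v)).congr fun k => hdv k i v
  have hdi : ∀ i, Tendsto (fun k => d k i) atTop (𝓝 (L (EuclideanSpace.single i 1) i)) := by
    intro i
    simpa using hLi (EuclideanSpace.single i 1) i
  have hsi : ∀ i, Tendsto (fun k => s k i) atTop (𝓝 (x i)) := fun i => by
    have h1 : Continuous fun x : EuclideanSpace ℝ ι => x i := by fun_prop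
    exact (h1.tendsto x).comp hs
  refine ⟨fun i => L (EuclideanSpace.single i 1) i, fun i => ⟨?_, ?_, fun h => ?_, fun h => ?_⟩,
    fun v i => tendsto_nhds_unique (hLi v i) ((hdi i).mul_const _)⟩
  · exact ge_of_tendsto' (hdi i) fun k => hd0 k i
  · exact le_of_tendsto' (hdi i) fun k => hd1 k i
  · refine tendsto_nhds_unique (hdi i) (tendsto_const_nhds.congr' ?_)
    filter_upwards [(hsi i).eventually_const_lt h] with k hk
    exact (hdp k i hk).symm
  · refine tendsto_nhds_unique (hdi i) (tendsto_const_nhds.congr' ?_)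
    filter_upwards [(hsi i).eventually_lt_const h] with k hk
    exact (hdn k i hk).symm

end Orthant

/-! ### The proximal mapping of one group. -/

section ShrinkPos

variable {ι : Type*} [Fintype ι]

/-- The proximal mapping of a group norm plus a squared norm on the nonnegative orthant. -/
def shrinkPos (κ ζ : ℝ) (x : EuclideanSpace ℝ ι) : EuclideanSpace ℝ ι :=
  shrink ζ (κ • posVec x)

/-- The sparse group function whose proximal mapping is `shrinkPos κ ζ`. -/
def groupPenalty (κ ζ : ℝ) (z : EuclideanSpace ℝ ι) : ℝ :=
  ζ / κ * ‖z‖ + (1 / κ - 1) / 2 * ‖z‖ ^ 2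

/-- A generalized Jacobian of `shrinkPos κ ζ`. -/
def shrinkPosJac (κ ζ : ℝ) (x : EuclideanSpace ℝ ι) :
    Set (EuclideanSpace ℝ ι →L[ℝ] EuclideanSpace ℝ ι) :=
  {J | ∃ J₁ ∈ shrinkJac ζ (κ • posVec x), ∃ J₂ ∈ posJac x, J = κ • J₁.comp J₂}

variable {κ ζ : ℝ}

theorem exists_shrink_eq_smul {E : Type*} [NormedAddCommGroup E] [InnerProductSpace ℝ E] {ζ : ℝ}
    (hζ : 0 ≤ ζ) (w : E) : ∃ s : ℝ, 0 ≤ s ∧ shrink ζ w = s • w := by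
  by_cases h : ‖w‖ ≤ ζ
  · exact ⟨0, le_rfl, by rw [shrink_of_le h, zero_smul]⟩
  · refine ⟨1 - ζ / ‖w‖, ?_, if_neg h⟩
    have h' : ζ < ‖w‖ := not_le.1 h
    rw [sub_nonneg, div_le_one (hζ.trans_lt h')]
    exact h'.le

theorem inner_shrinkPos_sub_eq (hζ : 0 ≤ ζ) (x : EuclideanSpace ℝ ι) :
    inner ℝ (shrinkPos κ ζ x) (posVec x - x) = 0 := by
  obtain ⟨s, -, hs⟩ := exists_shrink_eq_smul hζ (κ • posVec x)
  rw [shrinkPos, hs, inner_smul_left, inner_smul_left, inner_posVec_sub_eq, mul_zero, mul_zero]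

/-- The optimality condition of `shrink` at `κ • posVec x` is combined with that of the projection.
The latter survives the shrinking since `shrinkPos κ ζ x` is a multiple of `posVec x`. Division by κ
turns the factor 1 - κ into the weight 1/κ - 1 of the squared norm. -/
theorem isProx_shrinkPos (hκ : 0 < κ) (hκ1 : κ ≤ 1) (hζ : 0 ≤ ζ) :
    IsProx (orthant ι) (groupPenalty κ ζ) (shrinkPos κ ζ) where
  mem x i := by
    obtain ⟨s, hs0, hs⟩ := exists_shrink_eq_smul hζ (κ • posVec x)
    rw [shrinkPos, hs]
    have := posVec_mem x i
    simp only [PiLp.smul_apply, smul_eq_mul]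
    positivity
  le x z hz := by
    have h1 := shrink_vi hζ (κ • posVec x) z
    have h2 := inner_sub_posVec_nonneg hz x
    have h3 := inner_shrinkPos_sub_eq (κ := κ) hζ x
    change 0 ≤ ζ * (‖z‖ - ‖shrinkPos κ ζ x‖) +
      inner ℝ (z - shrinkPos κ ζ x) (shrinkPos κ ζ x - κ • posVec x) at h1
    set p := shrinkPos κ ζ x
    have e1 : z - x = (z - p) + (p - x) := by abel
    have e2 : inner ℝ (z - p) (p - κ • posVec x) =
        (1 - κ) * inner ℝ (z - p) p + κ * inner ℝ (z - p) (p - x) -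
          κ * inner ℝ (z - p) (posVec x - x) := by
      have : p - κ • posVec x = (1 - κ) • p + κ • (p - x) - κ • (posVec x - x) := by module
      rw [this, inner_sub_right, inner_add_right, inner_smul_right, inner_smul_right,
        inner_smul_right]
    have e3 : ‖z‖ ^ 2 = ‖z - p‖ ^ 2 + 2 * inner ℝ (z - p) p + ‖p‖ ^ 2 := by
      rw [← norm_add_sq_real, sub_add_cancel]
    have e4 : inner ℝ (z - p) (posVec x - x) = inner ℝ z (posVec x - x) := by
      rw [inner_sub_left, h3, sub_zero]
    rw [e2, e4] at h1
    unfold groupPenalty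
    rw [e1, norm_add_sq_real (z - p) (p - x), e3]
    have h5 : 0 ≤ (1 - κ) * ‖z - p‖ ^ 2 := mul_nonneg (by linarith) (by positivity)
    have h6 : 0 ≤ κ * inner ℝ z (posVec x - x) := by positivity
    have h7 : 0 ≤ 1 / κ * (ζ * (‖z‖ - ‖p‖) + (1 - κ) * inner ℝ (z - p) p +
        κ * inner ℝ (z - p) (p - x) + (1 - κ) / 2 * ‖z - p‖ ^ 2) :=
      mul_nonneg (by positivity) (by linarith)
    have e5 : 1 / κ * (ζ * (‖z‖ - ‖p‖) + (1 - κ) * inner ℝ (z - p) p +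
        κ * inner ℝ (z - p) (p - x) + (1 - κ) / 2 * ‖z - p‖ ^ 2) =
        ζ / κ * ‖z‖ - ζ / κ * ‖p‖ + (1 / κ - 1) * inner ℝ (z - p) p + inner ℝ (z - p) (p - x) +
          (1 / κ - 1) / 2 * ‖z - p‖ ^ 2 := by
      field_simp
    rw [e5] at h7
    linarith

/-- By complementarity only `posVec x` enters, so the trapezoidal estimate for `shrink` can be
reused. -/
theorem proxPotential_shrinkPos (hκ : 0 < κ) (hζ : 0 ≤ ζ) (x : EuclideanSpace ℝ ι) :
    proxPotential (groupPenalty κ ζ) (shrinkPos κ ζ) x =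
      1 / κ * proxPotential (fun z : EuclideanSpace ℝ ι => ζ * ‖z‖) (shrink ζ) (κ • posVec x) := by
  have h3 := inner_shrinkPos_sub_eq (κ := κ) hζ x
  rw [proxPotential, proxPotential, groupPenalty]
  change _ = 1 / κ * (inner ℝ (κ • posVec x) (shrinkPos κ ζ x) - 1 / 2 * ‖shrinkPos κ ζ x‖ ^ 2 -
    ζ * ‖shrinkPos κ ζ x‖)
  rw [inner_sub_right, sub_eq_zero] at h3
  rw [inner_smul_left, RCLike.conj_to_real, real_inner_comm _ (posVec x), h3, real_inner_comm]
  field_simp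
  ring

theorem eventually_sign (x₀ : EuclideanSpace ℝ ι) :
    ∀ᶠ x in 𝓝 x₀, ∀ i, (0 < x₀ i → 0 < x i) ∧ (x₀ i < 0 → x i < 0) := by
  refine eventually_all.2 fun i => ?_
  have hc : ContinuousAt (fun x : EuclideanSpace ℝ ι => x i) x₀ := by fun_prop
  refine Eventually.and ?_ ?_
  · by_cases h : 0 < x₀ i
    · exact (hc.eventually_const_lt h).mono fun x hx _ => hx
    · exact Eventually.of_forall fun x hx => absurd hx h
  · by_cases h : x₀ i < 0
    · exact (hc.eventually_lt_const h).mono fun x hx _ => hx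
    · exact Eventually.of_forall fun x hx => absurd hx h


/-- The projection is piecewise linear. Near x₀ an entry of `J` can be undetermined only where both
x and x₀ vanish, and there it is irrelevant. -/
theorem eventually_posJac_sub {x₀ : EuclideanSpace ℝ ι} : ∀ᶠ x in 𝓝 x₀, ∀ J ∈ posJac x,
    J (x - x₀) = posVec x - posVec x₀ := by
  filter_upwards [eventually_sign x₀] with x hx
  rintro J ⟨d, hd, hJ⟩
  ext i
  obtain ⟨-, -, hp, hn⟩ := hd i
  rw [hJ, PiLp.sub_apply, PiLp.sub_apply, posVec_apply, posVec_apply]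
  rcases lt_trichotomy (x₀ i) 0 with h | h | h
  · have h' := (hx i).2 h
    rw [hn h', max_eq_right h'.le, max_eq_right h.le]; ring
  · rw [h, max_self]
    rcases lt_trichotomy (x i) 0 with h' | h' | h'
    · rw [hn h', max_eq_right h'.le]; ring
    · rw [h', max_self]; ring
    · rw [hp h', max_eq_left h'.le]; ring
  · have h' := (hx i).1 h
    rw [hp h', max_eq_left h'.le, max_eq_left h.le]; ring

theorem norm_posVec_sub_le (x y : EuclideanSpace ℝ ι) : ‖posVec x - posVec y‖ ≤ ‖x - y‖ :=
  isProx_posVec.norm_sub_le x y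

/-- Near x₀, in each coordinate where x - x₀ differs from the difference of the projections, both
values of `shrinkPos` vanish. -/
theorem inner_shrinkPos_posVec_sub (hζ : 0 ≤ ζ) (x₀ : EuclideanSpace ℝ ι) : ∀ᶠ x in 𝓝 x₀,
    inner ℝ (shrinkPos κ ζ x + shrinkPos κ ζ x₀) (x - x₀) =
      inner ℝ (shrinkPos κ ζ x + shrinkPos κ ζ x₀) (posVec x - posVec x₀) := by
  filter_upwards [eventually_sign x₀] with x hx
  obtain ⟨s, -, hs⟩ := exists_shrink_eq_smul hζ (κ • posVec x)
  obtain ⟨s₀, -, hs₀⟩ := exists_shrink_eq_smul hζ (κ • posVec x₀)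
  rw [shrinkPos, shrinkPos, hs, hs₀, PiLp.inner_apply, PiLp.inner_apply]
  refine Finset.sum_congr rfl fun i _ => ?_
  simp only [PiLp.add_apply, PiLp.smul_apply, PiLp.sub_apply, posVec_apply, smul_eq_mul,
    RCLike.inner_apply, RCLike.conj_to_real]
  rcases lt_trichotomy (x₀ i) 0 with h | h | h
  · have h' := (hx i).2 h
    rw [max_eq_right h'.le, max_eq_right h.le]; ring
  · rw [h, max_self]
    rcases le_total (x i) 0 with h' | h'
    · rw [max_eq_right h']; ring
    · rw [max_eq_left h']
  · have h' := (hx i).1 h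
    rw [max_eq_left h'.le, max_eq_left h.le]

theorem posJac_symm {x : EuclideanSpace ℝ ι} {J : EuclideanSpace ℝ ι →L[ℝ] EuclideanSpace ℝ ι}
    (hJ : J ∈ posJac x) (a b : EuclideanSpace ℝ ι) : inner ℝ (J a) b = inner ℝ a (J b) := by
  obtain ⟨d, -, hJ⟩ := hJ
  rw [PiLp.inner_apply, PiLp.inner_apply]
  refine Finset.sum_congr rfl fun i _ => ?_
  simp only [hJ, RCLike.inner_apply, RCLike.conj_to_real]
  ring

theorem posJac_nonneg {x : EuclideanSpace ℝ ι} {J : EuclideanSpace ℝ ι →L[ℝ] EuclideanSpace ℝ ι}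
    (hJ : J ∈ posJac x) (a : EuclideanSpace ℝ ι) : 0 ≤ inner ℝ a (J a) := by
  obtain ⟨d, hd, hJ⟩ := hJ
  rw [PiLp.inner_apply]
  refine Finset.sum_nonneg fun i _ => ?_
  simp only [hJ, RCLike.inner_apply, RCLike.conj_to_real]
  nlinarith [mul_nonneg (hd i).1 (mul_self_nonneg (a i))]

theorem norm_posJac_le {x : EuclideanSpace ℝ ι} {J : EuclideanSpace ℝ ι →L[ℝ] EuclideanSpace ℝ ι}
    (hJ : J ∈ posJac x) (a : EuclideanSpace ℝ ι) : ‖J a‖ ≤ ‖a‖ := by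
  obtain ⟨d, hd, hJ⟩ := hJ
  rw [EuclideanSpace.norm_eq, EuclideanSpace.norm_eq]
  refine Real.sqrt_le_sqrt (Finset.sum_le_sum fun i _ => ?_)
  rw [hJ, norm_mul, Real.norm_eq_abs, abs_of_nonneg (hd i).1]
  exact pow_le_pow_left₀ (mul_nonneg (hd i).1 (norm_nonneg _))
    (mul_le_of_le_one_left (norm_nonneg _) (hd i).2.1) 2

/-- The quadratic form of an element of the generalized Jacobian. -/
theorem inner_shrinkPosJac {x : EuclideanSpace ℝ ι} {t : ℝ}
    {J₂ : EuclideanSpace ℝ ι →L[ℝ] EuclideanSpace ℝ ι} (hJ₂ : J₂ ∈ posJac x)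
    (a b : EuclideanSpace ℝ ι) :
    inner ℝ a ((κ • (t • shrinkDeriv ζ (κ • posVec x)).comp J₂) b) =
      κ * (t * ((1 - ζ / ‖κ • posVec x‖) * inner ℝ a (J₂ b) +
        ζ / ‖κ • posVec x‖ ^ 3 * (inner ℝ (κ • posVec x) a * inner ℝ (κ • posVec x) b))) := by
  have h1 : inner ℝ (κ • posVec x) (J₂ b) = inner ℝ (κ • posVec x) b := by
    rw [← posJac_symm hJ₂, map_smul, posJac_posVec hJ₂]
  rw [_root_.smul_apply, ContinuousLinearMap.comp_apply, _root_.smul_apply, shrinkDeriv_apply, h1,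
    inner_smul_right, inner_smul_right, inner_add_right, inner_smul_right, inner_smul_right,
    real_inner_comm (κ • posVec x) a]
  ring

theorem isSC1_shrinkPos (hκ : 0 < κ) (hκ1 : κ ≤ 1) (hζ : 0 ≤ ζ) :
    IsSC1 0 (proxPotential (groupPenalty κ ζ) (shrinkPos κ ζ)) (shrinkPos κ ζ)
      (shrinkPosJac (ι := ι) κ ζ) where
  lower x y := by
    simpa using (isProx_shrinkPos hκ hκ1 hζ).potential_lower x y
  lip := ⟨1, fun x y => by simpa using (isProx_shrinkPos hκ hκ1 hζ).norm_sub_le x y⟩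
  symm := by
    rintro x _ ⟨_, ⟨t, -, -, -, -, rfl⟩, J₂, hJ₂, rfl⟩ a b
    rw [real_inner_comm, inner_shrinkPosJac hJ₂, inner_shrinkPosJac hJ₂, ← posJac_symm hJ₂ b,
      real_inner_comm _ (J₂ b)]
    ring
  coercive := by
    rintro x _ ⟨_, ⟨t, ht0, -, htl, -, rfl⟩, J₂, hJ₂, rfl⟩ a
    rw [inner_shrinkPosJac hJ₂, zero_mul]
    refine mul_nonneg hκ.le ?_
    by_cases h : ‖κ • posVec x‖ < ζ
    · rw [htl h, zero_mul]
    · push Not at h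
      have h1 : 0 ≤ 1 - ζ / ‖κ • posVec x‖ :=
        sub_nonneg.2 (div_le_one_of_le₀ h (norm_nonneg _))
      have h2 := posJac_nonneg hJ₂ a
      have h3 := mul_self_nonneg (inner ℝ (κ • posVec x) a)
      positivity
  bound := by
    refine ⟨1, ?_⟩
    rintro x _ ⟨J₁, hJ₁, J₂, hJ₂, rfl⟩ a
    rw [_root_.smul_apply, ContinuousLinearMap.comp_apply, norm_smul, Real.norm_eq_abs,
      abs_of_pos hκ]
    refine mul_le_mul hκ1 ?_ (norm_nonneg _) zero_le_one
    exact (norm_shrinkJac_le hζ hJ₁ _).trans (norm_posJac_le hJ₂ a)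
  newton x₀ := by
    obtain ⟨C, hC0, hC⟩ := shrink_newton hζ (κ • posVec x₀)
    have hcont : Continuous fun x : EuclideanSpace ℝ ι => κ • posVec x :=
      (LipschitzWith.of_dist_le_mul (K := 1) fun x y => by
        simpa [dist_eq_norm] using norm_posVec_sub_le x y).continuous.const_smul κ
    refine ⟨C, ?_⟩
    filter_upwards [(hcont.tendsto x₀).eventually hC, eventually_posJac_sub (x₀ := x₀)] with x hx hx'
    rintro _ ⟨J₁, hJ₁, J₂, hJ₂, rfl⟩
    have h1 := hx J₁ hJ₁
    rw [← smul_sub] at h1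
    rw [_root_.smul_apply, ContinuousLinearMap.comp_apply, hx' J₂ hJ₂, ← map_smul]
    refine h1.trans ?_
    rw [norm_smul, Real.norm_eq_abs, abs_of_pos hκ]
    gcongr
    exact (mul_le_of_le_one_left (norm_nonneg _) hκ1).trans (norm_posVec_sub_le x x₀)
  trapezoid x₀ := by
    obtain ⟨C, hC0, hC⟩ := shrink_trapezoid hζ (κ • posVec x₀)
    have hcont : Continuous fun x : EuclideanSpace ℝ ι => κ • posVec x :=
      (LipschitzWith.of_dist_le_mul (K := 1) fun x y => by
        simpa [dist_eq_norm] using norm_posVec_sub_le x y).continuous.const_smul κ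
    refine ⟨1 / κ * C, ?_⟩
    filter_upwards [(hcont.tendsto x₀).eventually hC, inner_shrinkPos_posVec_sub (κ := κ) hζ x₀]
      with x hx hx'
    rw [proxPotential_shrinkPos hκ hζ, proxPotential_shrinkPos hκ hζ, hx']
    rw [← smul_sub, inner_smul_right, norm_smul, Real.norm_eq_abs, abs_of_pos hκ] at hx
    change |_ - _ - 1 / 2 * (κ * inner ℝ (shrinkPos κ ζ x + shrinkPos κ ζ x₀) _)| ≤ _ at hx
    have e : ∀ u v i : ℝ, 1 / κ * u - 1 / κ * v - 1 / 2 * i =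
        1 / κ * (u - v - 1 / 2 * (κ * i)) := by
      intro u v i; field_simp
    rw [e, abs_mul, abs_of_pos (by positivity : 0 < 1 / κ), mul_assoc]
    refine mul_le_mul_of_nonneg_left (hx.trans ?_) (by positivity)
    gcongr
    exact (mul_le_of_le_one_left (norm_nonneg _) hκ1).trans (norm_posVec_sub_le x x₀)

end ShrinkPos

/-! ### Indicator functions of the two slack cones. -/

section Cone

theorem indicatorFn_of_mem {ν : ℝ} {E : Type*} {K : Set E} {x : E} (h : x ∈ K) :
    indicatorFn K x = ((1 / ν * 0 : ℝ) : EReal) := by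
  simp [indicatorFn, h]

theorem indicatorFn_of_notMem {E : Type*} {K : Set E} {x : E} (h : x ∉ K) :
    indicatorFn K x = ⊤ := by
  simp [indicatorFn, h]

theorem isSC1_posVec {ι : Type*} [Fintype ι] :
    IsSC1 0 (proxPotential (fun _ => 0) posVec) posVec (posJac (ι := ι)) := by
  have h := isSC1_shrinkPos (ι := ι) (κ := 1) (ζ := 0) one_pos le_rfl le_rfl
  have e1 : groupPenalty (ι := ι) 1 0 = fun _ => 0 := by
    funext z; simp [groupPenalty]
  have e2 : shrinkPos (ι := ι) 1 0 = posVec := by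
    funext x; simp [shrinkPos]
  rw [e1, e2] at h
  refine h.mono fun x J hJ => ⟨ContinuousLinearMap.id ℝ _, ⟨1, zero_le_one, le_rfl, fun h => ?_,
    fun _ => rfl, by simp⟩, J, hJ, by simp⟩
  exact absurd h (not_lt.2 (norm_nonneg _))

/-- The regularity of the Moreau envelope of the indicator function of one of the two cones. -/
theorem exists_isSC1_cone (ι : Type*) [Fintype ι] (k : ConeKind) {σ : ℝ} (hσ : 0 < σ) :
    ∃ (φ : EuclideanSpace ℝ ι → ℝ) (F : EuclideanSpace ℝ ι → EuclideanSpace ℝ ι),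
      IsSC1 0 φ F (clarkeJacobian (prox σ (indicatorFn (k.cone ι)))) ∧
      (∀ y, moreauEnv σ (indicatorFn (k.cone ι)) y = 1 / (2 * σ) * ‖y‖ ^ 2 - 1 / σ * φ y) ∧
      ∀ y, (clarkeJacobian (prox σ (indicatorFn (k.cone ι))) y).Nonempty := by
  have main : ∀ (K : Set (EuclideanSpace ℝ ι)) (P : EuclideanSpace ℝ ι → EuclideanSpace ℝ ι)
      (J : EuclideanSpace ℝ ι → Set (EuclideanSpace ℝ ι →L[ℝ] EuclideanSpace ℝ ι)),
      IsProx K (fun _ => 0) P → IsSC1 0 (proxPotential (fun _ => 0) P) P J →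
      (∀ x, clarkeJacobian P x ⊆ J x) →
      ∃ (φ : EuclideanSpace ℝ ι → ℝ) (F : EuclideanSpace ℝ ι → EuclideanSpace ℝ ι),
      IsSC1 0 φ F (clarkeJacobian (prox σ (indicatorFn K))) ∧
      (∀ y, moreauEnv σ (indicatorFn K) y = 1 / (2 * σ) * ‖y‖ ^ 2 - 1 / σ * φ y) ∧
      ∀ y, (clarkeJacobian (prox σ (indicatorFn K)) y).Nonempty := by
    intro K P J hP hJ hsub
    have hprox := hP.prox_eq hσ (fun z hz => indicatorFn_of_mem hz)
      (fun z hz => indicatorFn_of_notMem hz)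
    refine ⟨_, P, hprox ▸ hJ.mono hsub, hP.moreauEnv_eq hσ (fun z hz => indicatorFn_of_mem hz)
      (fun z hz => indicatorFn_of_notMem hz), fun y => ?_⟩
    rw [hprox]
    exact clarkeJacobian_nonempty hP.norm_sub_le y
  cases k with
  | orthant => exact main _ posVec _ isProx_posVec isSC1_posVec clarkeJacobian_posVec_subset
  | zero =>
    refine main _ (fun _ => 0) (fun _ => {0}) isProx_zero ?_ clarkeJacobian_zero_subset
    have e : proxPotential (fun _ => 0) (fun _ : EuclideanSpace ℝ ι => 0) =
        fun x => inner ℝ (0 : EuclideanSpace ℝ ι) x + 0 := by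
      funext x; simp [proxPotential]
    rw [e]
    exact IsSC1.affine 0 0

end Cone

/-! ### Orthogonal decomposition of matrices along the partition. -/

section Groups

variable {m n : ℕ}

/-- `group G` as a linear map. -/
def groupL (G : Finset (Fin m × Fin n)) : Mat m n →L[ℝ] EuclideanSpace ℝ G :=
  LinearMap.toContinuousLinearMap
    { toFun := group G
      map_add' := fun _ _ => rfl
      map_smul' := fun _ _ => rfl }

@[simp]
theorem groupL_apply (G : Finset (Fin m × Fin n)) (X : Mat m n) : groupL G X = group G X := rfl

theorem group_apply (G : Finset (Fin m × Fin n)) (X : Mat m n) (i : G) : group G X i = X i := rfl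

/-- Extension of a vector on `G` by zero. -/
def extend (G : Finset (Fin m × Fin n)) (z : EuclideanSpace ℝ G) : Mat m n :=
  WithLp.toLp 2 fun ij => if h : ij ∈ G then z ⟨ij, h⟩ else 0

/-- It identifies the pulled-back operators of `IsSC1.comp` with block operators. -/
theorem groupL_adjoint_apply (G : Finset (Fin m × Fin n)) (z : EuclideanSpace ℝ G) :
    (groupL G).adjoint z = extend G z := by
  refine ext_inner_right ℝ fun X => ?_
  rw [ContinuousLinearMap.adjoint_inner_left, PiLp.inner_apply, PiLp.inner_apply]
  simp only [groupL_apply, group_apply, RCLike.inner_apply, RCLike.conj_to_real]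
  have h1 : ∀ i : G, X i * z i = (fun ij => X ij * extend G z ij) i := fun i => by
    simp [extend]
  rw [Finset.sum_congr rfl fun i _ => h1 i, Finset.sum_coe_sort G (fun ij => X ij * extend G z ij)]
  refine Finset.sum_subset (Finset.subset_univ _) fun i _ hi => ?_
  simp [extend, hi]

theorem group_extend (G : Finset (Fin m × Fin n)) (z : EuclideanSpace ℝ G) :
    group G (extend G z) = z := by
  ext i
  simp [group_apply, extend]

theorem group_extend_of_disjoint {G G' : Finset (Fin m × Fin n)} (h : Disjoint G G')
    (z : EuclideanSpace ℝ G') : group G (extend G' z) = 0 := by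
  ext i
  simp [group_apply, extend, Finset.disjoint_left.1 h i.2]

variable (𝒢 : Finpartition (Finset.univ : Finset (Fin m × Fin n)))

theorem group_sum_extend (z : ∀ G : Finset (Fin m × Fin n), EuclideanSpace ℝ G)
    {G : Finset (Fin m × Fin n)} (hG : G ∈ 𝒢.parts) :
    group G (∑ G' ∈ 𝒢.parts, extend G' (z G')) = z G := by
  rw [← groupL_apply, map_sum, Finset.sum_eq_single_of_mem G hG, groupL_apply, group_extend]
  intro G' hG' hne
  exact group_extend_of_disjoint (𝒢.disjoint hG hG' hne.symm) _

theorem ext_group {X Y : Mat m n} (h : ∀ G ∈ 𝒢.parts, group G X = group G Y) : X = Y := by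
  ext ij
  obtain ⟨G, hG, hij⟩ := 𝒢.exists_mem (Finset.mem_univ ij)
  exact congrArg (fun z : EuclideanSpace ℝ G => z ⟨ij, hij⟩) (h G hG)

theorem sum_extend_group (X : Mat m n) : ∑ G ∈ 𝒢.parts, extend G (group G X) = X :=
  ext_group 𝒢 fun _ hG => group_sum_extend 𝒢 (fun G => group G X) hG

theorem inner_eq_sum_group (X Y : Mat m n) :
    inner ℝ X Y = ∑ G ∈ 𝒢.parts, inner ℝ (group G X) (group G Y) := by
  conv_lhs => rw [← sum_extend_group 𝒢 X]
  rw [sum_inner]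
  refine Finset.sum_congr rfl fun G _ => ?_
  rw [← groupL_adjoint_apply, ContinuousLinearMap.adjoint_inner_left, groupL_apply]

theorem norm_sq_eq_sum_group (X : Mat m n) :
    ‖X‖ ^ 2 = ∑ G ∈ 𝒢.parts, ‖group G X‖ ^ 2 := by
  simp_rw [← real_inner_self_eq_norm_sq]
  exact inner_eq_sum_group 𝒢 X X

end Groups

/-! ### The proximal mapping of σp, group by group. -/

namespace Problem

variable {m n m' n' : ℕ} (D : Problem m n m' n') (Q : Subproblem m n m' n')

/-- The scaling factor `1 / (σ λ₂ + 1)`. -/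
def scale : ℝ := 1 / (Q.σ * D.lam₂ + 1)

/-- The threshold `σ λ₁ ω_G / (σ λ₂ + 1)`. -/
def threshold (G : Finset (Fin m × Fin n)) : ℝ :=
  Q.σ * D.lam₁ * D.ω G / (Q.σ * D.lam₂ + 1)

theorem one_le_denom : 1 ≤ Q.σ * D.lam₂ + 1 := by
  have := mul_nonneg Q.σ_pos.le D.lam₂_nonneg
  linarith

theorem scale_pos : 0 < D.scale Q :=
  one_div_pos.2 (one_pos.trans_le (D.one_le_denom Q))

theorem scale_le_one : D.scale Q ≤ 1 :=
  (div_le_one (one_pos.trans_le (D.one_le_denom Q))).2 (D.one_le_denom Q)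

theorem threshold_nonneg {G : Finset (Fin m × Fin n)} (hG : G ∈ D.groups.parts) :
    0 ≤ D.threshold Q G :=
  div_nonneg (mul_nonneg (mul_nonneg Q.σ_pos.le D.lam₁_nonneg) (D.ω_nonneg G hG))
    (zero_le_one.trans (D.one_le_denom Q))

/-- With κ the scale and ζ the threshold, ζ/κ = σ λ₁ ω_G and 1/κ - 1 = σ λ₂. -/
theorem groupPenalty_eq (G : Finset (Fin m × Fin n)) (z : EuclideanSpace ℝ G) :
    groupPenalty (D.scale Q) (D.threshold Q G) z =
      Q.σ * (D.lam₁ * (D.ω G * ‖z‖) + D.lam₂ / 2 * ‖z‖ ^ 2) := by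
  have h := one_pos.trans_le (D.one_le_denom Q)
  rw [groupPenalty, scale, threshold]
  field_simp
  ring

/-- The regularizer `σ p` on the nonnegative orthant. -/
def penalty (X : Mat m n) : ℝ :=
  ∑ G ∈ D.groups.parts, groupPenalty (D.scale Q) (D.threshold Q G) (group G X)

/-- The proximal mapping of `σ p`. -/
def proxP (X : Mat m n) : Mat m n :=
  ∑ G ∈ D.groups.parts, extend G (shrinkPos (D.scale Q) (D.threshold Q G) (group G X))

theorem group_proxP (X : Mat m n) {G : Finset (Fin m × Fin n)} (hG : G ∈ D.groups.parts) :
    group G (D.proxP Q X) = shrinkPos (D.scale Q) (D.threshold Q G) (group G X) :=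
  group_sum_extend D.groups
    (fun G => shrinkPos (D.scale Q) (D.threshold Q G) (group G X)) hG

theorem isProx_group {G : Finset (Fin m × Fin n)} (hG : G ∈ D.groups.parts) :
    IsProx (orthant G) (groupPenalty (D.scale Q) (D.threshold Q G))
      (shrinkPos (D.scale Q) (D.threshold Q G)) :=
  isProx_shrinkPos (D.scale_pos Q) (D.scale_le_one Q) (D.threshold_nonneg Q hG)

/-- Penalty, squared norm and orthant all split over the groups, so the inequalities of the groups
add up. -/
theorem isProx_proxP : IsProx (orthant (Fin m × Fin n)) (D.penalty Q) (D.proxP Q) where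
  mem X ij := by
    obtain ⟨G, hG, hij⟩ := D.groups.exists_mem (Finset.mem_univ ij)
    have h1 := (D.isProx_group Q hG).mem (group G X) ⟨ij, hij⟩
    rw [← D.group_proxP Q X hG] at h1
    exact h1
  le X Z hZ := by
    rw [norm_sq_eq_sum_group D.groups, norm_sq_eq_sum_group D.groups (Z - D.proxP Q X),
      norm_sq_eq_sum_group D.groups (Z - X), penalty, penalty, Finset.mul_sum, Finset.mul_sum,
      Finset.mul_sum, ← Finset.sum_add_distrib, ← Finset.sum_add_distrib,
      ← Finset.sum_add_distrib]
    refine Finset.sum_le_sum fun G hG => ?_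
    have h1 := (D.isProx_group Q hG).le (group G X) (group G Z) fun i => hZ i
    rw [← D.group_proxP Q X hG] at h1
    exact h1

theorem proxPotential_proxP (X : Mat m n) : proxPotential (D.penalty Q) (D.proxP Q) X =
    ∑ G ∈ D.groups.parts, proxPotential (groupPenalty (D.scale Q) (D.threshold Q G))
      (shrinkPos (D.scale Q) (D.threshold Q G)) (group G X) := by
  rw [proxPotential, inner_eq_sum_group D.groups, norm_sq_eq_sum_group D.groups, penalty,
    Finset.mul_sum, ← Finset.sum_sub_distrib, ← Finset.sum_sub_distrib]
  refine Finset.sum_congr rfl fun G hG => ?_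
  rw [D.group_proxP Q X hG, proxPotential]

theorem p_of_mem {X : Mat m n} (hX : X ∈ orthant (Fin m × Fin n)) :
    D.p X = ((1 / Q.σ * D.penalty Q X : ℝ) : EReal) := by
  have hσ := Q.σ_pos
  rw [p, indicatorFn, if_pos hX, add_zero, penalty, norm_sq_eq_sum_group D.groups]
  congr 1
  simp_rw [D.groupPenalty_eq Q]
  rw [← Finset.mul_sum, Finset.sum_add_distrib, ← Finset.mul_sum, ← Finset.mul_sum]
  field_simp

theorem p_of_notMem {X : Mat m n} (hX : X ∉ orthant (Fin m × Fin n)) : D.p X = ⊤ := by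
  rw [p, indicatorFn, if_neg hX]
  exact EReal.coe_add_top _

theorem prox_norm_eq {G : Finset (Fin m × Fin n)} (hG : G ∈ D.groups.parts) :
    prox 1 (fun z : EuclideanSpace ℝ G =>
      ((Q.σ * D.lam₁ * D.ω G / (Q.σ * D.lam₂ + 1) * ‖z‖ : ℝ) : EReal)) =
      shrink (D.threshold Q G) := by
  refine (isProx_shrink (D.threshold_nonneg Q hG)).prox_eq one_pos (fun z _ => ?_)
    fun z hz => absurd (Set.mem_univ z) hz
  rw [div_one, one_mul, threshold]

theorem jacXGroup_subset {G : Finset (Fin m × Fin n)} (hG : G ∈ D.groups.parts)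
    (x : EuclideanSpace ℝ G) :
    D.jacXGroup Q G x ⊆ shrinkPosJac (D.scale Q) (D.threshold Q G) x := by
  rintro J ⟨J₁, hJ₁, J₂, hJ₂, rfl⟩
  rw [D.prox_norm_eq Q hG, isProx_posVec.proj_eq] at hJ₁
  rw [isProx_posVec.proj_eq] at hJ₂
  exact ⟨J₁, clarkeJacobian_shrink_subset (D.threshold_nonneg Q hG) _ hJ₁, J₂,
    clarkeJacobian_posVec_subset x hJ₂, rfl⟩

theorem jacXGroup_nonempty {G : Finset (Fin m × Fin n)} (hG : G ∈ D.groups.parts)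
    (x : EuclideanSpace ℝ G) : (D.jacXGroup Q G x).Nonempty := by
  obtain ⟨J₁, hJ₁⟩ := clarkeJacobian_nonempty
    (isProx_shrink (E := EuclideanSpace ℝ G) (D.threshold_nonneg Q hG)).norm_sub_le
    ((1 / (Q.σ * D.lam₂ + 1)) • proj (orthant G) x)
  obtain ⟨J₂, hJ₂⟩ := clarkeJacobian_nonempty norm_posVec_sub_le x
  refine ⟨_, J₁, ?_, J₂, ?_, rfl⟩
  · rwa [D.prox_norm_eq Q hG]
  · rwa [isProx_posVec.proj_eq]

theorem jacX_nonempty (X : Mat m n) : (D.jacX Q X).Nonempty := by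
  classical
  have hex : ∀ G : Finset (Fin m × Fin n), ∃ J : EuclideanSpace ℝ G →L[ℝ] EuclideanSpace ℝ G,
      G ∈ D.groups.parts → J ∈ D.jacXGroup Q G (group G X) := fun G => by
    by_cases hG : G ∈ D.groups.parts
    · obtain ⟨J, hJ⟩ := D.jacXGroup_nonempty Q hG (group G X)
      exact ⟨J, fun _ => hJ⟩
    · exact ⟨0, fun h => absurd h hG⟩
  choose J hJ using hex
  refine ⟨∑ G ∈ D.groups.parts, (groupL G).adjoint ∘L J G ∘L groupL G, fun G hG =>
    ⟨J G, hJ G hG, fun Z => ?_⟩⟩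
  rw [_root_.sum_apply]
  simp only [ContinuousLinearMap.comp_apply, groupL_adjoint_apply, groupL_apply]
  exact group_sum_extend D.groups (fun G => J G (group G Z)) hG

/-- The Moreau envelope of `σ p`, with the surrogate Jacobian of its proximal mapping. -/
theorem exists_isSC1_p : ∃ (φ : Mat m n → ℝ) (F : Mat m n → Mat m n), IsSC1 0 φ F (D.jacX Q) ∧
    ∀ X, moreauEnv Q.σ D.p X = 1 / (2 * Q.σ) * ‖X‖ ^ 2 - 1 / Q.σ * φ X := by
  have hpiece := fun (G : Finset (Fin m × Fin n)) (hG : G ∈ D.groups.parts) =>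
    (isSC1_shrinkPos (ι := G) (D.scale_pos Q) (D.scale_le_one Q)
      (D.threshold_nonneg Q hG)).comp zero_le_one (groupL G) 0
  have hsum := IsSC1.sum D.groups.parts hpiece
  refine ⟨_, _, hsum.mono fun X J hJ => ?_, fun X => ?_⟩
  -- A member of `jacX` is determined by its blocks, hence is the sum of their pull-backs.
  · choose! JG hJG hJZ using hJ
    refine ⟨fun G => (1 : ℝ) • (groupL G).adjoint ∘L JG G ∘L groupL G, fun G hG => ?_, ?_⟩
    · refine ⟨JG G, ?_, rfl⟩
      rw [add_zero]
      exact D.jacXGroup_subset Q hG _ (hJG G hG)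
    · ext1 Z
      refine ext_group D.groups fun G hG => ?_
      rw [hJZ G hG, _root_.sum_apply]
      simp only [one_smul, ContinuousLinearMap.comp_apply, groupL_adjoint_apply, groupL_apply]
      exact (group_sum_extend D.groups (fun G => JG G (group G Z)) hG).symm
  · rw [(D.isProx_proxP Q).moreauEnv_eq Q.σ_pos (fun Z hZ => D.p_of_mem Q hZ)
      (fun Z hZ => D.p_of_notMem hZ), D.proxPotential_proxP Q]
    simp only [one_mul, add_zero, groupL_apply]

end Problem

/-! ### Adjoints of the block maps, and the structure of Ψ. -/

section BlockMaps

variable {m n m' n' : ℕ}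

/-- `upart` as a linear map. -/
def upartL : Vars m n m' n' →L[ℝ] EuclideanSpace ℝ (Fin m) :=
  LinearMap.toContinuousLinearMap
    { toFun := upart
      map_add' := fun _ _ => rfl
      map_smul' := fun _ _ => rfl }

/-- `vpart` as a linear map. -/
def vpartL : Vars m n m' n' →L[ℝ] EuclideanSpace ℝ (Fin n) :=
  LinearMap.toContinuousLinearMap
    { toFun := vpart
      map_add' := fun _ _ => rfl
      map_smul' := fun _ _ => rfl }

@[simp]
theorem upartL_apply (x : Vars m n m' n') : upartL x = upart x := rfl

@[simp]
theorem vpartL_apply (x : Vars m n m' n') : vpartL x = vpart x := rfl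

theorem inner_mkVars (W : Matrix (Fin m') (Fin n') ℝ) (u : Fin m → ℝ) (v : Fin n → ℝ)
    (x : Vars m n m' n') : inner ℝ (mkVars W u v) x =
      (∑ i, ∑ j, W i j * Wpart x i j) + (∑ i, u i * upart x i) + ∑ j, v j * vpart x j := by
  rw [PiLp.inner_apply, Fintype.sum_sum_type, Fintype.sum_sum_type, Fintype.sum_prod_type,
    ← add_assoc]
  simp [mkVars, Wpart, upart, vpart, mul_comm]

theorem upartL_adjoint_apply (u : EuclideanSpace ℝ (Fin m)) :
    (upartL (n := n) (m' := m') (n' := n')).adjoint u = mkVars 0 u 0 := by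
  refine ext_inner_right ℝ fun x => ?_
  rw [ContinuousLinearMap.adjoint_inner_left, inner_mkVars, PiLp.inner_apply]
  simp [mul_comm]

theorem vpartL_adjoint_apply (v : EuclideanSpace ℝ (Fin n)) :
    (vpartL (m := m) (m' := m') (n' := n')).adjoint v = mkVars 0 0 v := by
  refine ext_inner_right ℝ fun x => ?_
  rw [ContinuousLinearMap.adjoint_inner_left, inner_mkVars, PiLp.inner_apply]
  simp [mul_comm]

theorem sum_mul_eq_trace {k l : ℕ} (M N : Matrix (Fin k) (Fin l) ℝ) :
    ∑ i, ∑ j, M i j * N i j = (M.transpose * N).trace := by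
  rw [Finset.sum_comm]
  simp [Matrix.trace, Matrix.mul_apply]

end BlockMaps

namespace Problem

variable {m n m' n' : ℕ} (D : Problem m n m' n') (Q : Subproblem m n m' n')

/-- `lift` as a linear map. -/
def liftL : Vars m n m' n' →L[ℝ] Mat m n :=
  LinearMap.toContinuousLinearMap
    { toFun := D.lift
      map_add' := fun x y => by
        have hW : Wpart (x + y) = Wpart x + Wpart y := rfl
        ext ij
        simp only [lift, ofMatrix, hW, Matrix.mul_add, Matrix.add_mul, Matrix.add_apply,
          Matrix.of_apply, PiLp.add_apply, upart, vpart]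
        ring
      map_smul' := fun c x => by
        have hW : Wpart (c • x) = c • Wpart x := rfl
        ext ij
        simp only [lift, ofMatrix, hW, Matrix.mul_smul, Matrix.smul_mul, Matrix.add_apply,
          Matrix.of_apply, PiLp.smul_apply, upart, vpart, Matrix.smul_apply, smul_eq_mul,
          RingHom.id_apply]
        ring }

@[simp]
theorem liftL_apply (x : Vars m n m' n') : D.liftL x = D.lift x := rfl

/-- With this adjoint the operators of `jacGradPsi` become sums of terms σ T* J T and a multiple of
the identity. The W block follows from the cyclicity of the trace. -/
theorem liftL_adjoint_apply (Y : Mat m n) : D.liftL.adjoint Y =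
    mkVars (D.A * toMatrix Y * D.B) (fun i => ∑ j, toMatrix Y i j)
      (fun j => ∑ i, toMatrix Y i j) := by
  refine ext_inner_right ℝ fun x => ?_
  rw [ContinuousLinearMap.adjoint_inner_left, inner_mkVars, sum_mul_eq_trace, PiLp.inner_apply,
    Fintype.sum_prod_type]
  have h1 : (D.A * toMatrix Y * D.B).transpose * Wpart x =
      D.B.transpose * ((toMatrix Y).transpose * (D.A.transpose * Wpart x)) := by
    rw [Matrix.transpose_mul, Matrix.transpose_mul]
    simp only [Matrix.mul_assoc]
  have h2 : ((D.A * toMatrix Y * D.B).transpose * Wpart x).trace =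
      ∑ i, ∑ j, toMatrix Y i j * (D.A.transpose * Wpart x * D.B.transpose) i j := by
    rw [h1, Matrix.trace_mul_comm, sum_mul_eq_trace]
    simp only [Matrix.mul_assoc]
  have h3 : ∑ j, (∑ i, toMatrix Y i j) * vpart x j =
      ∑ i, ∑ j, toMatrix Y i j * vpart x j := by
    rw [Finset.sum_comm]
    simp only [Finset.sum_mul]
  rw [h2, h3]
  simp only [Finset.sum_mul]
  rw [← Finset.sum_add_distrib, ← Finset.sum_add_distrib]
  refine Finset.sum_congr rfl fun i _ => ?_
  rw [← Finset.sum_add_distrib, ← Finset.sum_add_distrib]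
  refine Finset.sum_congr rfl fun j _ => ?_
  simp only [liftL_apply, lift, ofMatrix, toMatrix, Matrix.add_apply, Matrix.of_apply,
    RCLike.inner_apply, RCLike.conj_to_real]
  ring

/-- The operator in the surrogate Jacobian of `∇Ψ` which belongs to `JX`, `JY`, `JZ`. -/
def newtonOperator (JX : Mat m n →L[ℝ] Mat m n)
    (JY : EuclideanSpace ℝ (Fin m) →L[ℝ] EuclideanSpace ℝ (Fin m))
    (JZ : EuclideanSpace ℝ (Fin n) →L[ℝ] EuclideanSpace ℝ (Fin n)) :
    Vars m n m' n' →L[ℝ] Vars m n m' n' :=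
  Q.σ • D.liftL.adjoint ∘L JX ∘L D.liftL + Q.σ • upartL.adjoint ∘L JY ∘L upartL +
    Q.σ • vpartL.adjoint ∘L JZ ∘L vpartL + (Q.τ / Q.σ) • ContinuousLinearMap.id ℝ _

theorem newtonOperator_apply (JX : Mat m n →L[ℝ] Mat m n)
    (JY : EuclideanSpace ℝ (Fin m) →L[ℝ] EuclideanSpace ℝ (Fin m))
    (JZ : EuclideanSpace ℝ (Fin n) →L[ℝ] EuclideanSpace ℝ (Fin n)) (h : Vars m n m' n') :
    D.newtonOperator Q JX JY JZ h =
    mkVars (Q.σ • (D.A * toMatrix (JX (D.lift h)) * D.B) + (Q.τ / Q.σ) • Wpart h)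
      (fun i => Q.σ * (∑ j, toMatrix (JX (D.lift h)) i j) + Q.σ * JY (upart h) i
        + Q.τ / Q.σ * upart h i)
      (fun j => Q.σ * (∑ i, toMatrix (JX (D.lift h)) i j) + Q.σ * JZ (vpart h) j
        + Q.τ / Q.σ * vpart h j) := by
  simp only [newtonOperator, _root_.add_apply, _root_.smul_apply, ContinuousLinearMap.comp_apply,
    liftL_adjoint_apply, upartL_adjoint_apply, vpartL_adjoint_apply, liftL_apply, upartL_apply,
    vpartL_apply, ContinuousLinearMap.id_apply]
  ext i
  rcases i with ⟨i, j⟩ | i | i <;> simp [mkVars, Wpart, upart, vpart]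

theorem jacGradPsi_nonempty (x : Vars m n m' n') : (D.jacGradPsi Q x).Nonempty := by
  obtain ⟨JX, hX⟩ := D.jacX_nonempty Q (D.argX Q x)
  obtain ⟨_, _, -, -, hr⟩ := exists_isSC1_cone (Fin m) D.Kr Q.σ_pos
  obtain ⟨_, _, -, -, hc⟩ := exists_isSC1_cone (Fin n) D.Kc Q.σ_pos
  obtain ⟨JY, hY⟩ := hr (Q.y + Q.σ • upart x)
  obtain ⟨JZ, hZ⟩ := hc (Q.z + Q.σ • vpart x)
  exact ⟨_, JX, hX, JY, hY, JZ, hZ, D.newtonOperator_apply Q JX JY JZ⟩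

/-- The envelope terms contribute modulus 0; all the strong convexity comes from the proximal term.
-/
theorem exists_isSC1_Psi : ∃ F, IsSC1 (Q.τ / Q.σ) (D.Psi Q) F (D.jacGradPsi Q) := by
  have hσ := Q.σ_pos
  have hτ := Q.τ_pos
  obtain ⟨φ, F, hφ, hφM⟩ := D.exists_isSC1_p Q
  obtain ⟨φr, Fr, hr, hrM, -⟩ := exists_isSC1_cone (Fin m) D.Kr hσ
  obtain ⟨φc, Fc, hc, hcM, -⟩ := exists_isSC1_cone (Fin n) D.Kc hσ
  have hσ' : 0 ≤ 1 / Q.σ := by positivity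
  have harg : ∀ x, (Q.σ • D.liftL) x + (Q.X - Q.σ • ofMatrix D.C) = D.argX Q x := fun x => by
    rw [_root_.smul_apply, liftL_apply, argX]
    module
  have hu : ∀ x : Vars m n m' n', (Q.σ • upartL) x + Q.y = Q.y + Q.σ • upart x := fun x => by
    rw [_root_.smul_apply, upartL_apply, add_comm]
  have hv : ∀ x : Vars m n m' n', (Q.σ • vpartL) x + Q.z = Q.z + Q.σ • vpart x := fun x => by
    rw [_root_.smul_apply, vpartL_apply, add_comm]
  have h := ((((hφ.comp hσ' (Q.σ • D.liftL) (Q.X - Q.σ • ofMatrix D.C)).add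
    (hr.comp hσ' (Q.σ • upartL) Q.y)).add (hc.comp hσ' (Q.σ • vpartL) Q.z)).add
    (IsSC1.quadratic (div_nonneg hτ.le hσ.le) Q.hat)).add
    (IsSC1.affine (mkVars (-D.S) (-D.α) (-D.β))
      (- (1 / (2 * Q.σ)) * (‖Q.X‖ ^ 2 + ‖Q.y‖ ^ 2 + ‖Q.z‖ ^ 2)))
  have e : (fun x => 1 / Q.σ * φ ((Q.σ • D.liftL) x + (Q.X - Q.σ • ofMatrix D.C)) +
      1 / Q.σ * φr ((Q.σ • upartL) x + Q.y) + 1 / Q.σ * φc ((Q.σ • vpartL) x + Q.z) +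
      Q.τ / Q.σ / 2 * ‖x - Q.hat‖ ^ 2 + (inner ℝ (mkVars (-D.S) (-D.α) (-D.β)) x +
      - (1 / (2 * Q.σ)) * (‖Q.X‖ ^ 2 + ‖Q.y‖ ^ 2 + ‖Q.z‖ ^ 2))) = D.Psi Q := by
    funext x
    rw [harg, hu, hv, inner_mkVars, Psi, augLagrangian, hφM, pr, pc, hrM, hcM, PiLp.inner_apply,
      PiLp.inner_apply]
    simp only [Matrix.neg_apply, PiLp.neg_apply, neg_mul, Finset.sum_neg_distrib,
      RCLike.inner_apply, RCLike.conj_to_real, mul_comm (upart x _), mul_comm (vpart x _)]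
    ring
  rw [e, zero_add, zero_add, zero_add, add_zero] at h
  refine ⟨_, h.mono fun x H hH => ?_⟩
  obtain ⟨JX, hX, JY, hY, JZ, hZ, hH⟩ := hH
  -- The outer factor 1/σ and the two factors σ from the substitution combine to σ.
  have hcomp : ∀ {E : Type} [NormedAddCommGroup E] [InnerProductSpace ℝ E] [CompleteSpace E]
      (T : Vars m n m' n' →L[ℝ] E) (K : E →L[ℝ] E),
      (1 / Q.σ) • (Q.σ • T).adjoint ∘L K ∘L (Q.σ • T) = Q.σ • T.adjoint ∘L K ∘L T := by
    intro E _ _ _ T K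
    ext1 x
    simp only [_root_.smul_apply, ContinuousLinearMap.comp_apply, map_smul, smul_smul]
    congr 1
    field_simp
  refine ⟨_, ⟨_, ⟨_, ⟨_, ⟨JX, (harg x).symm ▸ hX, rfl⟩, _, ⟨JY, (hu x).symm ▸ hY, rfl⟩, rfl⟩, _,
    ⟨JZ, (hv x).symm ▸ hZ, rfl⟩, rfl⟩, _, rfl, rfl⟩, 0, rfl, ?_⟩
  rw [add_zero, hcomp, hcomp, hcomp]
  ext1 d
  rw [hH, ← D.newtonOperator_apply, newtonOperator]

end Problem

/-! ### The semismooth Newton method as an instance of the abstract method. -/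

namespace Problem

variable {m n m' n' : ℕ} (D : Problem m n m' n') (Q : Subproblem m n m' n') (R : SSNParams)

theorem isSC1_Psi : IsSC1 (Q.τ / Q.σ) (D.Psi Q) (gradient (D.Psi Q)) (D.jacGradPsi Q) := by
  obtain ⟨F, hF⟩ := D.exists_isSC1_Psi Q
  rwa [gradient_eq (hF.hasGradientAt (div_nonneg Q.τ_pos.le Q.σ_pos.le))]

theorem isInexactDirection {x d : Vars m n m' n'} {H : Vars m n m' n' →L[ℝ] Vars m n m' n'}
    (hH : H ∈ D.jacGradPsi Q x) (hd : D.IsDirection Q R H x d) :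
    IsInexactDirection R.ηbar R.γ H (gradient (D.Psi Q) x) d := by
  rcases hd with hd | ⟨⟨P, hP, k, rfl⟩, hd⟩
  · refine ⟨?_, ?_⟩
    · rw [hd, inner_neg_right, neg_neg, real_inner_comm]
    · rw [hd, neg_add_cancel, norm_zero]
      exact le_min R.ηbar_mem.1.le (by positivity)
  · refine ⟨?_, hd⟩
    have h := inner_pcg_d ((D.isSC1_Psi Q).isSPD (div_pos Q.τ_pos Q.σ_pos) hH) hP
      (- gradient (D.Psi Q) x) k
    rw [inner_neg_left] at h
    linarith

theorem newtonStep_of_ssnStep {x x' : Vars m n m' n'} (h : D.SSNStep Q R x x') :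
    NewtonStep R (D.Psi Q) (gradient (D.Psi Q)) (D.jacGradPsi Q) x x' := by
  obtain ⟨H, hH, d, hd, i, hi, rfl⟩ := h
  exact ⟨H, hH, d, D.isInexactDirection Q R hH hd, i, hi, rfl⟩

theorem exists_armijo {x d : Vars m n m' n'} {H : Vars m n m' n' →L[ℝ] Vars m n m' n'}
    (hH : H ∈ D.jacGradPsi Q x) (hd : D.IsDirection Q R H x d) : ∃ i, D.Armijo Q R x d i :=
  (D.isSC1_Psi Q).exists_armijo (div_pos Q.τ_pos Q.σ_pos) R
    ((D.isSC1_Psi Q).inner_direction_le hH (D.isInexactDirection Q R hH hd))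

theorem exists_ssnStep (x : Vars m n m' n') : ∃ x', D.SSNStep Q R x x' := by
  classical
  obtain ⟨H, hH⟩ := D.jacGradPsi_nonempty Q x
  obtain ⟨d, hd⟩ := ((D.isSC1_Psi Q).isSPD (div_pos Q.τ_pos Q.σ_pos) hH).exists_solution
    (- gradient (D.Psi Q) x)
  have hA := D.exists_armijo Q R hH (Or.inl hd)
  exact ⟨_, H, hH, d, Or.inl hd, Nat.find hA,
    ⟨Nat.find_spec hA, fun _ hi => Nat.find_min' hA hi⟩, rfl⟩

end Problem

end OT

end
theorem theorem4p1 {m n m' n' : ℕ} (D : OT.Problem m n m' n') (Q : OT.Subproblem m n m' n')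
    (R : OT.SSNParams) :
    -- the equation `∇Ψ = 0` has a unique solution `xs`
    Differentiable ℝ (D.Psi Q) ∧
    ∃ xs : OT.Vars m n m' n', (∀ x, gradient (D.Psi Q) x = 0 ↔ x = xs) ∧
    -- the method is well defined: each of its steps can be carried out, whatever choices are made
    (∀ x, (D.jacGradPsi Q x).Nonempty ∧ ∀ H ∈ D.jacGradPsi Q x, OT.IsSPD H ∧
      (∃ d, H d = - gradient (D.Psi Q) x) ∧
      (∀ P, OT.IsSPD P →
        ∃ k, D.ResidualTest Q R H x (OT.pcg H P (- gradient (D.Psi Q) x) k).d) ∧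
      ∀ d, D.IsDirection Q R H x d → ∃ i, D.Armijo Q R x d i) ∧
    (∀ x₀, ∃ x : ℕ → OT.Vars m n m' n', x 0 = x₀ ∧ D.IsSSNSequence Q R x) ∧
    -- convergence, and the local rate
    ∀ x : ℕ → OT.Vars m n m' n', D.IsSSNSequence Q R x →
      Filter.Tendsto x Filter.atTop (nhds xs) ∧
      ∃ c : ℝ, ∃ J : ℕ, ∀ j ≥ J, ‖x (j + 1) - xs‖ ≤ c * ‖x j - xs‖ ^ (1 + R.γ) := by
  have hκ : 0 < Q.τ / Q.σ := div_pos Q.τ_pos Q.σ_pos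
  have h := D.isSC1_Psi Q
  obtain ⟨xs, hxs⟩ := h.exists_zero hκ
  have hxs0 : gradient (D.Psi Q) xs = 0 := (hxs xs).2 rfl
  refine ⟨fun x => (h.hasGradientAt hκ.le x).differentiableAt, xs, hxs, fun x =>
    ⟨D.jacGradPsi_nonempty Q x, fun H hH => ⟨h.isSPD hκ hH, (h.isSPD hκ hH).exists_solution _,
      fun P hP => ?_, fun d hd => D.exists_armijo Q R hH hd⟩⟩, fun x₀ => ?_, fun x hx => ?_⟩
  -- The test is passed at the latest when the iterate is the exact solution, with residual zero.
  · obtain ⟨k, hk⟩ := OT.exists_pcg_eq (h.isSPD hκ hH) hP (- gradient (D.Psi Q) x)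
    refine ⟨k, ?_⟩
    rw [OT.Problem.ResidualTest, hk, neg_add_cancel, norm_zero]
    exact le_min R.ηbar_mem.1.le (by positivity)
  · choose f hf using D.exists_ssnStep Q R
    refine ⟨fun j => f^[j] x₀, rfl, fun j => ?_⟩
    simp only [Function.iterate_succ_apply']
    exact hf _
  · have hx' := fun j => D.newtonStep_of_ssnStep Q R (hx j)
    exact ⟨h.tendsto_of_newtonStep hκ R hxs0 hx', h.rate_of_newtonStep hκ R hxs0 hx'⟩
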